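/- Let $T_k$ denote the Chebyshev polynomials of the first kind, and for $\alpha\in\mathbb{N}_0^n$ put $T_\alpha(\mathbf{x})=\prod_{i=1}^n T_{\alpha_i}(x_i)$. These form a basis of $\mathbb{R}[x_1,\dots,x_n]$; for $f=\sum_\alpha f_\alpha T_\alpha$ let $\|f\|_{1,\mathrm{cheb}}=\sum_\alpha|f_\alpha|$. Let $\Sigma[\mathbf{x}]_r$ be the set of sums of squares of polynomials that have total degree at most $r$, and let $d\mu(y)=\frac{dy}{\pi\sqrt{1-y^2}}$ be the Chebyshev probability measure on $[-1,1]$. For integers $s\ge 1$ and $N\ge 0$ put $a_j=j/s$ and $$S_s(x,y)=1+2\sum_{j=1}^s(1-a_j)T_j(x)T_j(y),\qquad M_s(x)=1+2\sum_{j=1}^s(1-a_j)^2T_j(x)^2,$$ $$C_s=1+2\sum_{j=1}^s(1-a_j)^2,\qquad p_{s,N}(x)=\frac1{C_s}\sum_{m=0}^N\Bigl(1-\frac{M_s(x)}{C_s}\Bigr)^m .$$ **Theorem.** There exist absolute constants $0<c_1\le 70458$ and $0<c_2\le 540$ such that the following holds. Let $f=\sum_{|\alpha|\le d}f_\alpha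 T_\alpha\in\mathbb{R}[x_1,\dots,x_n]$ be a polynomial of total degree at most $d$ that is nonnegative on $[-1,1]^n$. Then for every integer $r\ge 2$ with $n\mid r$ and $r/\log_2 r\ge c_2n^2d^2$ there is a $p\in\Sigma[\mathbf{x}]_r$ with $$\|p-f\|_{1,\mathrm{cheb}}\le c_1n^3d^2\,\|f\|_{1,\mathrm{cheb}}\,\frac{\log_2^3 r}{r^2}.$$ Moreover, $p$ can be chosen as the image of $f$ under the squared Fejér kernel operator, multiplied by a truncated geometric series: there are an integer $s\ge1$ and an even integer $N\ge2$ such that $p_{s,N}$ is a sum of squares and, for all $\mathbf{x}\in[-1,1]^n$, $$p(\mathbf{x})=\prod_{i=1}^n p_{s,N}(x_i)\int_{[-1,1]^n}f(\mathbf{y})\prod_{i=1}^n S_s(x_i,y_i)^2\,d\mu(y_1)\cdots d\mu(y_n).$$ -/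

import Mathlib

open MeasureTheory

noncomputable section

namespace ChebSOS

/-! ### The multivariate Chebyshev basis and the associated coefficient norm -/

/-- The multivariate Chebyshev polynomial `T_α(x) = ∏ i, T_{α i}(x i)`. -/
def chebT {n : ℕ} (α : Fin n →₀ ℕ) : MvPolynomial (Fin n) ℝ :=
  ∏ i, Polynomial.aeval (MvPolynomial.X i) (Polynomial.Chebyshev.T ℝ (α i : ℤ))

/-- The univariate Chebyshev polynomials, as a basis of `ℝ[X]`. -/
def uniBasis : Module.Basis ℕ ℝ (Polynomial ℝ) :=
  (Polynomial.Chebyshev.chebyshevTsequence ℝ).basis (fun i => by simp)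

theorem uniBasis_apply (k : ℕ) : uniBasis k = Polynomial.Chebyshev.T ℝ (k : ℤ) := by
  simp [uniBasis, Polynomial.Chebyshev.chebyshevTsequence]

/-- Auxiliary functional, reading off the coefficient of `chebT β`. -/
def coeffDual {n : ℕ} (β : Fin n →₀ ℕ) : MvPolynomial (Fin n) ℝ →ₗ[ℝ] ℝ :=
  (MvPolynomial.basisMonomials (Fin n) ℝ).constr ℝ
    (fun α => ∏ i, uniBasis.repr (Polynomial.X ^ (α i)) (β i))

theorem coeffDual_monomial {n : ℕ} (α β : Fin n →₀ ℕ) :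
    coeffDual β (MvPolynomial.monomial α 1) =
      ∏ i, uniBasis.repr (Polynomial.X ^ (α i)) (β i) := by
  have h := (MvPolynomial.basisMonomials (Fin n) ℝ).constr_basis ℝ
    (fun α : Fin n →₀ ℕ => ∏ i, uniBasis.repr (Polynomial.X ^ (α i)) (β i)) α
  simpa [coeffDual] using h

theorem prod_X_pow {n : ℕ} (m : Fin n → ℕ) :
    (∏ i, (MvPolynomial.X i : MvPolynomial (Fin n) ℝ) ^ (m i)) =
      MvPolynomial.monomial (Finsupp.equivFunOnFinite.symm m) 1 := by
  rw [MvPolynomial.monomial_eq]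
  simp [Finsupp.prod_fintype]

theorem coeffDual_prod {n : ℕ} (q : Fin n → Polynomial ℝ) (β : Fin n →₀ ℕ) :
    coeffDual β (∏ i, Polynomial.aeval (MvPolynomial.X i) (q i)) =
      ∏ i, uniBasis.repr (q i) (β i) := by
  have h1 : ∀ i, Polynomial.aeval (MvPolynomial.X i : MvPolynomial (Fin n) ℝ) (q i) =
      ∑ k ∈ (q i).support, (q i).coeff k • (MvPolynomial.X i) ^ k := by
    intro i
    rw [Polynomial.aeval_def, Polynomial.eval₂_eq_sum, Polynomial.sum_def]
    simp [Algebra.smul_def]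
  have h2 : ∀ i, uniBasis.repr (q i) (β i) =
      ∑ k ∈ (q i).support, (q i).coeff k * uniBasis.repr (Polynomial.X ^ k) (β i) := by
    intro i
    conv_lhs => rw [(q i).as_sum_support_C_mul_X_pow]
    simp [← Polynomial.smul_eq_C_mul, Finsupp.finsetSum_apply]
  simp_rw [h1, h2]
  rw [Finset.prod_univ_sum, Finset.prod_univ_sum, map_sum]
  refine Finset.sum_congr rfl fun m _ => ?_
  simp_rw [Finset.prod_smul, Finset.prod_mul_distrib]
  rw [prod_X_pow, map_smul, coeffDual_monomial]
  simp

theorem chebT_linearIndependent (n : ℕ) :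
    LinearIndependent ℝ (chebT : (Fin n →₀ ℕ) → MvPolynomial (Fin n) ℝ) := by
  refine LinearIndependent.of_pairwise_dual_eq_zero_one _ (fun β => coeffDual β) ?_ ?_
  · intro β α h
    rw [chebT, coeffDual_prod]
    obtain ⟨i, hi⟩ := DFunLike.ne_iff.mp h
    refine Finset.prod_eq_zero (Finset.mem_univ i) ?_
    rw [← uniBasis_apply, Module.Basis.repr_self, Finsupp.single_apply, if_neg]
    exact fun h' => hi h'.symm
  · intro α
    rw [chebT, coeffDual_prod]
    refine Finset.prod_eq_one fun i _ => ?_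
    rw [← uniBasis_apply, Module.Basis.repr_self, Finsupp.single_eq_same]

theorem chebT_span (n : ℕ) :
    ⊤ ≤ Submodule.span ℝ (Set.range (chebT : (Fin n →₀ ℕ) → MvPolynomial (Fin n) ℝ)) := by
  rw [← (MvPolynomial.basisMonomials (Fin n) ℝ).span_eq, Submodule.span_le]
  rintro _ ⟨α, rfl⟩
  have h0 : (MvPolynomial.basisMonomials (Fin n) ℝ) α =
      ∏ i, (MvPolynomial.X i : MvPolynomial (Fin n) ℝ) ^ (α i) := by
    rw [prod_X_pow]; simp
  have h1 : ∀ i, (MvPolynomial.X i : MvPolynomial (Fin n) ℝ) ^ (α i) =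
      ∑ k ∈ (uniBasis.repr (Polynomial.X ^ (α i))).support,
        uniBasis.repr (Polynomial.X ^ (α i)) k •
          Polynomial.aeval (MvPolynomial.X i : MvPolynomial (Fin n) ℝ)
            (Polynomial.Chebyshev.T ℝ (k : ℤ)) := by
    intro i
    have h := congrArg (Polynomial.aeval (MvPolynomial.X i : MvPolynomial (Fin n) ℝ))
      (uniBasis.linearCombination_repr (Polynomial.X ^ (α i)))
    rw [Finsupp.linearCombination_apply, Finsupp.sum, map_sum] at h
    simp only [map_smul, uniBasis_apply, map_pow, Polynomial.aeval_X] at h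
    exact h.symm
  rw [h0]
  simp_rw [h1]
  rw [Finset.prod_univ_sum]
  refine Submodule.sum_mem _ fun m _ => ?_
  rw [Finset.prod_smul]
  refine Submodule.smul_mem _ _ (Submodule.subset_span ⟨Finsupp.equivFunOnFinite.symm m, ?_⟩)
  simp [chebT]

/-- The Chebyshev basis `(T_α)` of `ℝ[x_1, …, x_n]`. -/
def chebBasis (n : ℕ) : Module.Basis (Fin n →₀ ℕ) ℝ (MvPolynomial (Fin n) ℝ) :=
  Module.Basis.mk (chebT_linearIndependent n) (chebT_span n)

theorem chebBasis_apply {n : ℕ} (α : Fin n →₀ ℕ) : chebBasis n α = chebT α := by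
  simp [chebBasis]

/-- The 1-norm of the coefficients of `f` in the Chebyshev basis. -/
def chebNorm {n : ℕ} (f : MvPolynomial (Fin n) ℝ) : ℝ :=
  ((chebBasis n).repr f).sum fun _ c => |c|

/-! ### Sums of squares and the hypercube -/

/-- The cone of sums of squares of polynomials, of total degree at most `r`. -/
def sosCone (n r : ℕ) : Set (MvPolynomial (Fin n) ℝ) :=
  {p | IsSumSq p ∧ p.totalDegree ≤ r}

/-- The hypercube `[-1,1]^n`. -/
def cube (n : ℕ) : Set (Fin n → ℝ) := Set.pi Set.univ fun _ => Set.Icc (-1) 1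

/-! ### The squared kernel and its operator -/

/-- The Chebyshev probability measure `dx / (π √(1 - x²))` on `[-1,1]`. -/
def chebMeasure : Measure ℝ :=
  (ENNReal.ofReal Real.pi)⁻¹ • Polynomial.Chebyshev.measureT

/-- The univariate kernel `S(x,y) = 1 + 2 ∑_{j=1}^s (1 - a_j) T_j(x) T_j(y)`. -/
def kerS (a : ℕ → ℝ) (s : ℕ) (x y : ℝ) : ℝ :=
  1 + 2 * ∑ j ∈ Finset.Icc 1 s, (1 - a j) * (Polynomial.Chebyshev.T ℝ (j : ℤ)).eval x *
    (Polynomial.Chebyshev.T ℝ (j : ℤ)).eval y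

/-- The squared-kernel operator
`(𝒦 f)(x) = ∫_{[-1,1]^n} f(y) ∏ i, S(x_i, y_i)² dμ(y_1) ⋯ dμ(y_n)`. -/
def kerOp {n : ℕ} (a : ℕ → ℝ) (s : ℕ) (f : MvPolynomial (Fin n) ℝ) (x : Fin n → ℝ) : ℝ :=
  ∫ y, MvPolynomial.eval y f * ∏ i, kerS a s (x i) (y i) ^ 2
    ∂(Measure.pi fun _ : Fin n => chebMeasure)

/-- `M(x) = 1 + 2 ∑_{j=1}^s (1 - a_j)² T_j(x)²`, the image of `1` under the univariate
squared-kernel operator. -/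
def kerM (a : ℕ → ℝ) (s : ℕ) : Polynomial ℝ :=
  1 + 2 * ∑ j ∈ Finset.Icc 1 s,
    Polynomial.C ((1 - a j) ^ 2) * Polynomial.Chebyshev.T ℝ (j : ℤ) ^ 2

/-- `C = 1 + 2 ∑_{j=1}^s (1 - a_j)²`. -/
def kerC (a : ℕ → ℝ) (s : ℕ) : ℝ := 1 + 2 * ∑ j ∈ Finset.Icc 1 s, (1 - a j) ^ 2

/-- The truncated geometric series `C⁻¹ ∑_{m=0}^N (1 - M/C)^m` for `1 / M`. -/
def geomTrunc (a : ℕ → ℝ) (s N : ℕ) : Polynomial ℝ :=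
  Polynomial.C (kerC a s)⁻¹ *
    ∑ m ∈ Finset.range (N + 1), (1 - Polynomial.C (kerC a s)⁻¹ * kerM a s) ^ m

/-- The Fejér weights `a_j = j / s` for `j ≤ s` (extended by `1`). -/
def fejer (s j : ℕ) : ℝ := if j ≤ s then (j : ℝ) / s else 1

end ChebSOS

end

noncomputable section

namespace ChebSOS

/-- The 1-norm of the coordinates of a vector in a given basis. -/
def coordNorm {ι V : Type*} [AddCommGroup V] [Module ℝ V] (b : Module.Basis ι ℝ V) (v : V) : ℝ :=
  (b.repr v).sum fun _ c => |c|

section CoordNorm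

variable {ι κ V W : Type*} [AddCommGroup V] [Module ℝ V] [AddCommGroup W] [Module ℝ W]
  (b : Module.Basis ι ℝ V) (b' : Module.Basis κ ℝ W)

theorem coordNorm_nonneg (v : V) : 0 ≤ coordNorm b v :=
  Finset.sum_nonneg fun _ _ => abs_nonneg _

theorem coordNorm_zero : coordNorm b 0 = 0 := by simp [coordNorm]

theorem coordNorm_self (i : ι) : coordNorm b (b i) = 1 := by
  simp [coordNorm]

theorem coordNorm_add_le (v w : V) : coordNorm b (v + w) ≤ coordNorm b v + coordNorm b w := by
  classical
  unfold coordNorm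
  rw [Finsupp.sum_of_support_subset (s := (b.repr v).support ∪ (b.repr w).support) (b.repr (v + w))
      (by rw [map_add]; exact Finsupp.support_add) _ (by simp),
    Finsupp.sum_of_support_subset (b.repr v) Finset.subset_union_left _ (by simp),
    Finsupp.sum_of_support_subset (b.repr w) Finset.subset_union_right _ (by simp),
    ← Finset.sum_add_distrib]
  refine Finset.sum_le_sum fun i _ => ?_
  rw [map_add]
  exact abs_add_le _ _

theorem coordNorm_smul (c : ℝ) (v : V) : coordNorm b (c • v) = |c| * coordNorm b v := by
  unfold coordNorm
  rw [map_smul, Finsupp.sum_smul_index (by simp), Finsupp.sum, Finsupp.sum, Finset.mul_sum]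
  exact Finset.sum_congr rfl fun i _ => abs_mul _ _

theorem coordNorm_sum_le {τ : Type*} (s : Finset τ) (f : τ → V) :
    coordNorm b (∑ i ∈ s, f i) ≤ ∑ i ∈ s, coordNorm b (f i) :=
  Finset.le_sum_of_subadditive _ (coordNorm_zero b).le (coordNorm_add_le b) s f

/-- A linear map is bounded by its values on the basis vectors that occur. -/
theorem coordNorm_map_le (Φ : V →ₗ[ℝ] W) (v : V) (B : ℝ)
    (h : ∀ i ∈ (b.repr v).support, coordNorm b' (Φ (b i)) ≤ B) :
    coordNorm b' (Φ v) ≤ B * coordNorm b v := by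
  have hv : Φ v = ∑ i ∈ (b.repr v).support, b.repr v i • Φ (b i) := by
    conv_lhs => rw [← b.linearCombination_repr v]
    rw [Finsupp.linearCombination_apply, Finsupp.sum, map_sum]
    simp
  rw [hv]
  refine (coordNorm_sum_le b' _ _).trans ?_
  rw [coordNorm, Finsupp.sum, Finset.mul_sum]
  refine Finset.sum_le_sum fun i hi => ?_
  rw [coordNorm_smul, mul_comm]
  exact mul_le_mul_of_nonneg_right (h i hi) (abs_nonneg _)

end CoordNorm

theorem chebNorm_eq_coordNorm {n : ℕ} (f : MvPolynomial (Fin n) ℝ) :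
    chebNorm f = coordNorm (chebBasis n) f := rfl

/-! ### The univariate norm -/

open Polynomial
open Polynomial.Chebyshev hiding C C_mul

theorem coordNorm_T (k : ℤ) : coordNorm uniBasis (T ℝ k) = 1 := by
  rw [← T_natAbs, ← uniBasis_apply, coordNorm_self]

theorem coordNorm_one : coordNorm uniBasis 1 = 1 := by
  rw [← T_zero, coordNorm_T]

theorem T_mul_T_eq (j k : ℤ) : T ℝ j * T ℝ k = (1 / 2 : ℝ) • (T ℝ (j + k) + T ℝ (j - k)) := by
  rw [← T_mul_T, mul_assoc, ← map_ofNat (C : ℝ →+* ℝ[X]) 2, ← smul_eq_C_mul, smul_smul]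
  norm_num

theorem coordNorm_T_mul_T_le (j k : ℤ) : coordNorm uniBasis (T ℝ j * T ℝ k) ≤ 1 := by
  rw [T_mul_T_eq, coordNorm_smul]
  have := coordNorm_add_le uniBasis (T ℝ (j + k)) (T ℝ (j - k))
  rw [coordNorm_T, coordNorm_T] at this
  rw [abs_of_pos (by norm_num)]
  linarith

theorem coordNorm_mul_le (p q : ℝ[X]) :
    coordNorm uniBasis (p * q) ≤ coordNorm uniBasis p * coordNorm uniBasis q := by
  refine coordNorm_map_le uniBasis uniBasis (LinearMap.mulLeft ℝ p) q _ fun j _ => ?_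
  rw [LinearMap.mulLeft_apply, mul_comm p]
  have := coordNorm_map_le uniBasis uniBasis (LinearMap.mulLeft ℝ (uniBasis j)) p 1 fun i _ => by
    rw [LinearMap.mulLeft_apply, uniBasis_apply, uniBasis_apply]
    exact coordNorm_T_mul_T_le _ _
  simpa using this

theorem coordNorm_pow_le_one {p : ℝ[X]} (hp : coordNorm uniBasis p ≤ 1) (m : ℕ) :
    coordNorm uniBasis (p ^ m) ≤ 1 := by
  induction m with
  | zero => rw [pow_zero, coordNorm_one]
  | succ m ih =>
    rw [pow_succ]
    exact (coordNorm_mul_le _ _).trans (mul_le_one₀ ih (coordNorm_nonneg _ _) hp)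

theorem uniBasis_repr_eq_zero {q : ℝ[X]} {k : ℕ} (hk : q.natDegree < k) :
    uniBasis.repr q k = 0 := by
  have hq : q ∈ degreeLT ℝ (q.natDegree + 1) := by
    rw [mem_degreeLT]
    exact degree_le_natDegree.trans_lt (by exact_mod_cast Nat.lt_succ_self _)
  rw [← Sequence.span_degreeLT (chebyshevTsequence ℝ) (by simp)] at hq
  have h : ((chebyshevTsequence ℝ : Sequence ℝ) : ℕ → ℝ[X]) = uniBasis := by
    ext1 i
    simp [uniBasis]
  rw [h, Module.Basis.mem_span_image] at hq
  by_contra hne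
  have := hq (Finsupp.mem_support_iff.mpr hne)
  simp only [Set.mem_Iio] at this
  omega

/-! ### Products of univariate polynomials in distinct variables -/

/-- The polynomial `q` in the variable `x_i`. -/
abbrev inVar {n : ℕ} (i : Fin n) (q : ℝ[X]) : MvPolynomial (Fin n) ℝ :=
  aeval (MvPolynomial.X i) q

theorem chebBasis_repr_apply {n : ℕ} (f : MvPolynomial (Fin n) ℝ) (β : Fin n →₀ ℕ) :
    (chebBasis n).repr f β = coeffDual β f := by
  have : (chebBasis n).coord β = coeffDual β := by
    refine (chebBasis n).ext fun α => ?_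
    rw [chebBasis_apply, chebT, coeffDual_prod, ← chebT, ← chebBasis_apply]
    simp_rw [← uniBasis_apply, Module.Basis.repr_self]
    simp only [Module.Basis.coord_apply, Module.Basis.repr_self]
    by_cases h : α = β
    · subst h; simp
    · rw [Finsupp.single_apply, if_neg h]
      obtain ⟨i, hi⟩ := DFunLike.ne_iff.mp h
      exact (Finset.prod_eq_zero (Finset.mem_univ i) (by rw [Finsupp.single_apply, if_neg hi])).symm
  rw [← this, Module.Basis.coord_apply]

theorem sum_le_of_mem_support_repr {n d : ℕ} {f : MvPolynomial (Fin n) ℝ} (hf : f.totalDegree ≤ d)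
    {β : Fin n →₀ ℕ} (hβ : β ∈ ((chebBasis n).repr f).support) : ∑ i, β i ≤ d := by
  by_contra! hlt
  refine Finsupp.mem_support_iff.mp hβ ?_
  rw [chebBasis_repr_apply, f.as_sum, map_sum]
  refine Finset.sum_eq_zero fun α hα => ?_
  have h1 : MvPolynomial.monomial α (f.coeff α) =
      f.coeff α • (MvPolynomial.monomial α (1 : ℝ)) := by
    simp [MvPolynomial.smul_monomial]
  rw [h1, map_smul, coeffDual_monomial]
  have h2 : ∑ i, α i ≤ d := by
    have := (MvPolynomial.le_totalDegree hα).trans hf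
    rwa [Finsupp.sum_fintype _ _ (by simp)] at this
  obtain ⟨i, -, hi⟩ := Finset.exists_lt_of_sum_lt (h2.trans_lt hlt)
  rw [Finset.prod_eq_zero (Finset.mem_univ i), smul_zero]
  exact uniBasis_repr_eq_zero (by simpa using hi)

theorem chebNorm_prod_le {n : ℕ} (q : Fin n → ℝ[X]) :
    chebNorm (∏ i, inVar i (q i)) ≤ ∏ i, coordNorm uniBasis (q i) := by
  have h1 : ∀ i, inVar i (q i) =
      ∑ k ∈ (uniBasis.repr (q i)).support, uniBasis.repr (q i) k • inVar i (T ℝ (k : ℤ)) := by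
    intro i
    have h := congrArg (aeval (MvPolynomial.X i : MvPolynomial (Fin n) ℝ))
      (uniBasis.linearCombination_repr (q i))
    rw [Finsupp.linearCombination_apply, Finsupp.sum, map_sum] at h
    simp only [map_smul, uniBasis_apply] at h
    exact h.symm
  simp_rw [h1, coordNorm, Finsupp.sum]
  rw [Finset.prod_univ_sum, Finset.prod_univ_sum, chebNorm_eq_coordNorm]
  refine (coordNorm_sum_le _ _ _).trans (Finset.sum_le_sum fun m _ => ?_)
  have h2 : ∏ i, inVar i (T ℝ (m i : ℤ)) = chebBasis n (Finsupp.equivFunOnFinite.symm m) := by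
    rw [chebBasis_apply, chebT]; rfl
  rw [Finset.prod_smul, h2, coordNorm_smul, coordNorm_self, mul_one, Finset.abs_prod]

/-- Perturbation of a product: if `‖E i‖ ≤ ε i` and `‖B i‖ ≤ 1`, then `∏ (B i + E i)` is within
`exp (∑ ε i) - 1` of `∏ B i`. -/
theorem chebNorm_prod_add_sub_prod_le {n : ℕ} (B E : Fin n → ℝ[X]) (ε : Fin n → ℝ)
    (hB : ∀ i, coordNorm uniBasis (B i) ≤ 1) (hE : ∀ i, coordNorm uniBasis (E i) ≤ ε i) :
    chebNorm (∏ i, inVar i (B i + E i) - ∏ i, inVar i (B i)) ≤ Real.exp (∑ i, ε i) - 1 := by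
  classical
  have hε : ∀ i, 0 ≤ ε i := fun i => (coordNorm_nonneg _ _).trans (hE i)
  have h1 : ∏ i, inVar i (B i + E i) - ∏ i, inVar i (B i) =
      ∑ t ∈ (Finset.univ : Finset (Fin n)).powerset.erase ∅,
        ∏ i, inVar i (if i ∈ t then E i else B i) := by
    have h : ∀ i, inVar i (B i + E i) = inVar i (E i) + inVar i (B i) := fun i => by
      rw [inVar, map_add, add_comm]
    simp_rw [h]
    rw [Finset.prod_add, ← Finset.add_sum_erase _ _ (Finset.empty_mem_powerset _)]
    simp only [Finset.prod_empty, Finset.sdiff_empty, one_mul, add_sub_cancel_left]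
    refine Finset.sum_congr rfl fun t _ => ?_
    rw [← Finset.prod_sdiff (Finset.subset_univ t), mul_comm]
    congr 1
    · exact Finset.prod_congr rfl fun i hi => by rw [if_neg (Finset.mem_sdiff.mp hi).2]
    · exact Finset.prod_congr rfl fun i hi => by rw [if_pos hi]
  have h2 : ∏ i, (ε i + 1) - 1 = ∑ t ∈ (Finset.univ : Finset (Fin n)).powerset.erase ∅,
      ∏ i ∈ t, ε i := by
    rw [Finset.prod_add, ← Finset.add_sum_erase _ _ (Finset.empty_mem_powerset _)]
    simp
  have h3 : ∏ i, (ε i + 1) ≤ Real.exp (∑ i, ε i) := by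
    rw [Real.exp_sum]
    exact Finset.prod_le_prod (fun i _ => by linarith [hε i]) fun i _ => Real.add_one_le_exp _
  refine le_trans ?_ (sub_le_sub_right h3 1)
  rw [h1, h2, chebNorm_eq_coordNorm]
  refine (coordNorm_sum_le _ _ _).trans (Finset.sum_le_sum fun t _ => ?_)
  refine (chebNorm_prod_le _).trans ?_
  rw [← Finset.prod_sdiff (Finset.subset_univ t)]
  have h4 : ∏ i ∈ Finset.univ \ t, coordNorm uniBasis (if i ∈ t then E i else B i) ≤ 1 :=
    Finset.prod_le_one (fun i _ => coordNorm_nonneg _ _) fun i hi => by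
      rw [if_neg (Finset.mem_sdiff.mp hi).2]; exact hB i
  have h5 : ∏ i ∈ t, coordNorm uniBasis (if i ∈ t then E i else B i) ≤ ∏ i ∈ t, ε i :=
    Finset.prod_le_prod (fun i _ => coordNorm_nonneg _ _) fun i hi => by
      rw [if_pos hi]; exact hE i
  exact (mul_le_mul h4 h5 (Finset.prod_nonneg fun i _ => coordNorm_nonneg _ _) zero_le_one).trans
    (one_mul _).le

theorem totalDegree_inVar_le {n : ℕ} (i : Fin n) (q : ℝ[X]) :
    (inVar i q).totalDegree ≤ q.natDegree := by
  rw [inVar, aeval_eq_sum_range]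
  refine MvPolynomial.totalDegree_finsetSum_le fun k hk => ?_
  refine (MvPolynomial.totalDegree_smul_le _ _).trans ?_
  rw [MvPolynomial.totalDegree_X_pow]
  exact Nat.lt_succ_iff.mp (Finset.mem_range.mp hk)

theorem eval_inVar {n : ℕ} (i : Fin n) (q : ℝ[X]) (x : Fin n → ℝ) :
    MvPolynomial.eval x (inVar i q) = q.eval (x i) := by
  rw [inVar, ← MvPolynomial.coe_aeval_eq_eval, RingHom.coe_coe, ← aeval_algHom_apply]
  simp

/-! ### The Chebyshev mean and Gauss quadrature -/

instance : IsFiniteMeasure measureT :=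
  ((integrable_const_iff_isFiniteMeasure (one_ne_zero : (1 : ℝ) ≠ 0)).mp
    (integrable_measureT continuousOn_const))

instance : IsFiniteMeasure chebMeasure :=
  Measure.smul_finite _ (ENNReal.inv_ne_top.mpr (by simp [Real.pi_pos]))

theorem integral_chebMeasure (g : ℝ → ℝ) :
    ∫ x, g x ∂chebMeasure = Real.pi⁻¹ * ∫ x, g x ∂measureT := by
  rw [chebMeasure, integral_smul_measure, ENNReal.toReal_inv,
    ENNReal.toReal_ofReal Real.pi_pos.le, smul_eq_mul]

theorem integrable_eval_chebMeasure (q : ℝ[X]) :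
    Integrable (fun x => q.eval x) chebMeasure :=
  (integrable_measureT q.continuous.continuousOn).smul_measure
    (ENNReal.inv_ne_top.mpr (by simp [Real.pi_pos]))

/-- The mean of a polynomial with respect to the Chebyshev measure. -/
def chebMean : ℝ[X] →ₗ[ℝ] ℝ where
  toFun q := ∫ x, q.eval x ∂chebMeasure
  map_add' p q := by
    simp_rw [eval_add]
    exact integral_add (integrable_eval_chebMeasure p) (integrable_eval_chebMeasure q)
  map_smul' c q := by
    simp_rw [eval_smul, RingHom.id_apply]
    exact integral_smul _ _

theorem chebMean_apply (q : ℝ[X]) : chebMean q = ∫ x, q.eval x ∂chebMeasure := rfl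

theorem chebMean_T (m : ℤ) : chebMean (T ℝ m) = if m = 0 then 1 else 0 := by
  rw [chebMean_apply, integral_chebMeasure]
  split_ifs with h
  · rw [h, integral_eval_T_real_measureT_zero, inv_mul_cancel₀ Real.pi_ne_zero]
  · rw [integral_eval_T_real_measureT_of_ne_zero h, mul_zero]

/-- The Chebyshev nodes. -/
def chebNode (Q : ℕ) (i : Fin Q) : ℝ := Real.cos ((2 * (i : ℕ) + 1) / (2 * Q) * Real.pi)

theorem chebNode_mem (Q : ℕ) (i : Fin Q) : chebNode Q i ∈ Set.Icc (-1 : ℝ) 1 :=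
  Real.cos_mem_Icc _

theorem chebMean_eq_sum_chebNode {Q : ℕ} {q : ℝ[X]} (hq : q.natDegree < 2 * Q) :
    chebMean q = ∑ i : Fin Q, (Q : ℝ)⁻¹ * q.eval (chebNode Q i) := by
  have hQ : Q ≠ 0 := by omega
  have hdeg : q.degree < 2 * Q := degree_le_natDegree.trans_lt (by exact_mod_cast hq)
  rw [chebMean_apply, integral_chebMeasure, integral_eq_sumZeroes hQ hdeg, sumZeroes,
    Finset.sum_range, ← Finset.mul_sum, ← mul_assoc]
  congr 1
  field_simp [Real.pi_ne_zero]

theorem abs_chebMean_le {q : ℝ[X]} {B : ℝ} (h : ∀ x ∈ Set.Icc (-1 : ℝ) 1, |q.eval x| ≤ B) :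
    |chebMean q| ≤ B := by
  set Q := q.natDegree + 1 with hQ
  rw [chebMean_eq_sum_chebNode (Q := Q) (by omega)]
  have hQ0 : (0 : ℝ) < Q := by positivity
  calc |∑ i : Fin Q, (Q : ℝ)⁻¹ * q.eval (chebNode Q i)|
      ≤ ∑ i : Fin Q, |(Q : ℝ)⁻¹ * q.eval (chebNode Q i)| := Finset.abs_sum_le_sum_abs _ _
    _ ≤ ∑ i : Fin Q, (Q : ℝ)⁻¹ * B := Finset.sum_le_sum fun i _ => by
        rw [abs_mul, abs_of_pos (inv_pos.mpr hQ0)]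
        exact mul_le_mul_of_nonneg_left (h _ (chebNode_mem Q i)) (inv_pos.mpr hQ0).le
    _ = B := by
        rw [Finset.sum_const, Finset.card_univ, Fintype.card_fin, nsmul_eq_mul, ← mul_assoc,
          mul_inv_cancel₀ hQ0.ne', one_mul]

theorem uniBasis_repr_eq_chebMean (q : ℝ[X]) (k : ℕ) :
    uniBasis.repr q k = (if k = 0 then 1 else 2) * chebMean (q * T ℝ (k : ℤ)) := by
  have : uniBasis.coord k = (if k = 0 then 1 else 2 : ℝ) •
      (chebMean ∘ₗ LinearMap.mulRight ℝ (T ℝ (k : ℤ))) := by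
    refine uniBasis.ext fun j => ?_
    rw [Module.Basis.coord_apply, Module.Basis.repr_self]
    simp only [LinearMap.smul_apply,
      LinearMap.comp_apply, LinearMap.mulRight_apply, uniBasis_apply, T_mul_T_eq, map_smul, map_add,
      chebMean_T, smul_eq_mul, Finsupp.single_apply]
    by_cases h : j = k
    · by_cases h0 : k = 0
      · norm_num [h, h0]
      · have : ¬ ((k : ℤ) + k = 0) := by omega
        simp [h, h0, this]
    · have h1 : ¬ ((j : ℤ) + k = 0) := by omega
      have h2 : ¬ ((j : ℤ) - k = 0) := by omega
      simp [h, h1, h2]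
  rw [← Module.Basis.coord_apply, this]
  rfl

theorem abs_eval_T_le_one (k : ℤ) {x : ℝ} (hx : x ∈ Set.Icc (-1 : ℝ) 1) :
    |(T ℝ k).eval x| ≤ 1 := by
  rw [← Real.cos_arccos hx.1 hx.2, T_real_cos]
  exact Real.abs_cos_le_one _

theorem coordNorm_le_of_abs_le {q : ℝ[X]} {B : ℝ}
    (h : ∀ x ∈ Set.Icc (-1 : ℝ) 1, |q.eval x| ≤ B) :
    coordNorm uniBasis q ≤ 2 * (q.natDegree + 1) * B := by
  have hB : 0 ≤ B := (abs_nonneg _).trans (h 0 (by simp))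
  have hcoef : ∀ k, |uniBasis.repr q k| ≤ 2 * B := fun k => by
    rw [uniBasis_repr_eq_chebMean, abs_mul]
    refine mul_le_mul (by split_ifs <;> norm_num) (abs_chebMean_le fun x hx => ?_)
      (abs_nonneg _) zero_le_two
    rw [eval_mul, abs_mul]
    exact (mul_le_mul (h x hx) (abs_eval_T_le_one _ hx) (abs_nonneg _) hB).trans (mul_one B).le
  rw [coordNorm, Finsupp.sum_of_support_subset (s := Finset.range (q.natDegree + 1)) _ _ _
    (by simp)]
  · refine (Finset.sum_le_sum fun k _ => hcoef k).trans ?_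
    rw [Finset.sum_const, Finset.card_range, nsmul_eq_mul]
    push_cast
    linarith
  · intro k hk
    by_contra hk'
    exact Finsupp.mem_support_iff.mp hk (uniBasis_repr_eq_zero (by simpa using hk'))

/-! ### Moments of the squared kernel -/

theorem sum_Icc_neg {M : Type*} [AddCommMonoid M] (g : ℤ → M) (s : ℤ) :
    ∑ j ∈ Finset.Icc (-s) s, g (-j) = ∑ j ∈ Finset.Icc (-s) s, g j :=
  Finset.sum_equiv (Equiv.neg ℤ) (by simp; omega) (by simp)

theorem sum_Icc_neg_of_even {g : ℤ → ℝ} (hg : ∀ j, g (-j) = g j) (s : ℕ) :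
    ∑ j ∈ Finset.Icc (-s : ℤ) s, g j = g 0 + 2 * ∑ j ∈ Finset.Icc 1 s, g (j : ℤ) := by
  rw [Finset.sum_Icc_of_even_eq_range hg, Finset.sum_range_succ', ← Finset.Ico_add_one_right_eq_Icc,
    Finset.sum_Ico_eq_sum_range]
  simp only [Nat.add_sub_cancel, add_comm 1, nsmul_eq_mul, Nat.cast_zero]
  push_cast
  ring

/-- The kernel `∑_{|j| ≤ s} b_j T_j(x) T_j(y)` as a polynomial in `x`. -/
def kerPoly (b : ℤ → ℝ) (s : ℕ) (y : ℝ) : ℝ[X] :=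
  ∑ j ∈ Finset.Icc (-s : ℤ) s, C (b j * (T ℝ j).eval y) * T ℝ j

theorem eval_kerPoly (b : ℤ → ℝ) (s : ℕ) (x y : ℝ) :
    (kerPoly b s y).eval x =
      ∑ j ∈ Finset.Icc (-s : ℤ) s, b j * (T ℝ j).eval y * (T ℝ j).eval x := by
  simp [kerPoly, eval_finsetSum]

theorem eval_kerPoly_comm (b : ℤ → ℝ) (s : ℕ) (x y : ℝ) :
    (kerPoly b s y).eval x = (kerPoly b s x).eval y := by
  simp_rw [eval_kerPoly, mul_right_comm]

section Moments

variable {b : ℤ → ℝ} {s : ℕ}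

theorem natDegree_kerPoly_le (hb : ∀ j : ℤ, s ≤ j.natAbs → b j = 0) (y : ℝ) :
    (kerPoly b s y).natDegree ≤ s - 1 := by
  refine natDegree_sum_le_of_forall_le _ _ fun j _ => ?_
  by_cases hj : s ≤ j.natAbs
  · simp [hb j hj]
  · refine (natDegree_C_mul_le _ _).trans ?_
    rw [natDegree_T]
    omega

theorem chebMean_T_mul_T_mul_T (k j l : ℤ) :
    chebMean (T ℝ k * (T ℝ j * T ℝ l)) = 1 / 4 * ((if l = -(k + j) then 1 else 0) +
      (if l = k + j then 1 else 0) + (if l = j - k then 1 else 0) +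
      (if l = k - j then 1 else 0)) := by
  have h1 : (k + (j + l) = 0) ↔ l = -(k + j) := by omega
  have h2 : (k - (j + l) = 0) ↔ l = k - j := by omega
  have h3 : (k + (j - l) = 0) ↔ l = k + j := by omega
  have h4 : (k - (j - l) = 0) ↔ l = j - k := by omega
  simp only [T_mul_T_eq j l, mul_smul_comm, mul_add, T_mul_T_eq k, map_smul, map_add, chebMean_T,
    smul_eq_mul, h1, h2, h3, h4]
  ring

theorem chebMean_T_mul_kerPoly_sq (heven : ∀ j, b (-j) = b j)
    (hb : ∀ j : ℤ, s ≤ j.natAbs → b j = 0) (k : ℤ) (x : ℝ) :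
    chebMean (T ℝ k * kerPoly b s x ^ 2) = ∑ j ∈ Finset.Icc (-s : ℤ) s,
      (b j * (T ℝ j).eval x) * (b (j + k) * (T ℝ (j + k)).eval x) := by
  set g : ℤ → ℝ := fun j => b j * (T ℝ j).eval x with hg
  have gneg : ∀ j, g (-j) = g j := fun j => by simp only [hg, heven, T_neg]
  have gzero : ∀ j ∉ Finset.Icc (-s : ℤ) s, g j = 0 := fun j hj => by
    rw [Finset.mem_Icc] at hj
    simp only [hg]
    rw [hb j (by omega), zero_mul]
  have hpick : ∀ m, ∑ l ∈ Finset.Icc (-s : ℤ) s, g l * (if l = m then 1 else 0) = g m := by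
    intro m
    simp only [mul_ite, mul_one, mul_zero, Finset.sum_ite_eq']
    split_ifs with h
    · rfl
    · exact (gzero m h).symm
  have hk : kerPoly b s x = ∑ j ∈ Finset.Icc (-s : ℤ) s, C (g j) * T ℝ j := rfl
  change _ = ∑ j ∈ Finset.Icc (-s : ℤ) s, g j * g (j + k)
  clear_value g
  have h1 : T ℝ k * kerPoly b s x ^ 2 = ∑ j ∈ Finset.Icc (-s : ℤ) s, ∑ l ∈ Finset.Icc (-s : ℤ) s,
      (g j * g l) • (T ℝ k * (T ℝ j * T ℝ l)) := by
    rw [pow_two, hk, Finset.sum_mul_sum, Finset.mul_sum]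
    refine Finset.sum_congr rfl fun j _ => ?_
    rw [Finset.mul_sum]
    refine Finset.sum_congr rfl fun l _ => ?_
    rw [smul_eq_C_mul, map_mul C]
    ring
  have h2 : ∀ j, ∑ l ∈ Finset.Icc (-s : ℤ) s, (g j * g l) * chebMean (T ℝ k * (T ℝ j * T ℝ l)) =
      1 / 2 * (g j * g (j + k)) + 1 / 2 * (g j * g (j - k)) := by
    intro j
    simp_rw [chebMean_T_mul_T_mul_T]
    have : ∀ l, g j * g l * (1 / 4 * ((if l = -(k + j) then 1 else 0) +
        (if l = k + j then 1 else 0) + (if l = j - k then 1 else 0) +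
        (if l = k - j then 1 else 0))) = 1 / 4 * g j * (g l * (if l = -(k + j) then 1 else 0)) +
        1 / 4 * g j * (g l * (if l = k + j then 1 else 0)) +
        1 / 4 * g j * (g l * (if l = j - k then 1 else 0)) +
        1 / 4 * g j * (g l * (if l = k - j then 1 else 0)) := fun l => by ring
    simp_rw [this, Finset.sum_add_distrib, ← Finset.mul_sum, hpick]
    rw [gneg, add_comm k j, ← neg_sub j k, gneg]
    ring
  rw [h1, map_sum]
  simp_rw [map_sum, map_smul, smul_eq_mul, h2, Finset.sum_add_distrib, ← Finset.mul_sum]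
  have h3 : ∑ j ∈ Finset.Icc (-s : ℤ) s, g j * g (j - k) =
      ∑ j ∈ Finset.Icc (-s : ℤ) s, g j * g (j + k) := by
    rw [← sum_Icc_neg]
    refine Finset.sum_congr rfl fun j _ => ?_
    rw [gneg, ← gneg (-j - k)]
    ring_nf
  rw [h3]
  ring

theorem sum_Icc_neg_sub {M : Type*} [AddCommMonoid M] (g : ℤ → M) (s k : ℤ) :
    ∑ j ∈ Finset.Icc (-s - k) s, g (-k - j) = ∑ j ∈ Finset.Icc (-s - k) s, g j :=
  Finset.sum_equiv (Equiv.subLeft (-k)) (by simp; omega) (by simp)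

/-- The defect of the squared-kernel operator on `T_k` is a sum over squared differences of the
weights. -/
theorem sum_mul_eval_T_sub_chebMean (heven : ∀ j, b (-j) = b j)
    (hb : ∀ j : ℤ, s ≤ j.natAbs → b j = 0) (k : ℕ) (x : ℝ) :
    (∑ j ∈ Finset.Icc (-s : ℤ) s, b j ^ 2 * (T ℝ j).eval x ^ 2) * (T ℝ (k : ℤ)).eval x -
      chebMean (T ℝ (k : ℤ) * kerPoly b s x ^ 2) =
    ∑ j ∈ Finset.Icc (-s - k : ℤ) s, 1 / 2 * (b j - b (j + k)) ^ 2 *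
      ((T ℝ j).eval x * (T ℝ (j + k)).eval x) := by
  have hTT : ∀ i j : ℤ, 2 * (T ℝ i).eval x * (T ℝ j).eval x =
      (T ℝ (i + j)).eval x + (T ℝ (i - j)).eval x := fun i j => by
    simpa using congrArg (eval x) (T_mul_T ℝ i j)
  have hext : ∀ h : ℤ → ℝ, (∀ j, b j = 0 → h j = 0) →
      ∑ j ∈ Finset.Icc (-s : ℤ) s, h j = ∑ j ∈ Finset.Icc (-s - k : ℤ) s, h j := by
    intro h hh
    refine Finset.sum_subset (Finset.Icc_subset_Icc (by omega) le_rfl) fun j _ hj => hh j (hb j ?_)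
    rw [Finset.mem_Icc] at hj
    omega
  have h1 : (∑ j ∈ Finset.Icc (-s : ℤ) s, b j ^ 2 * (T ℝ j).eval x ^ 2) * (T ℝ (k : ℤ)).eval x =
      ∑ j ∈ Finset.Icc (-s : ℤ) s, b j ^ 2 * ((T ℝ j).eval x * (T ℝ (j + k)).eval x) := by
    have e1 : ∑ j ∈ Finset.Icc (-s : ℤ) s, b j ^ 2 * ((T ℝ j).eval x * (T ℝ (j - k)).eval x) =
        ∑ j ∈ Finset.Icc (-s : ℤ) s, b j ^ 2 * ((T ℝ j).eval x * (T ℝ (j + k)).eval x) := by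
      rw [← sum_Icc_neg]
      refine Finset.sum_congr rfl fun j _ => ?_
      rw [heven, T_neg, show -j - (k : ℤ) = -(j + k) by ring, T_neg]
    have e2 : (∑ j ∈ Finset.Icc (-s : ℤ) s, b j ^ 2 * (T ℝ j).eval x ^ 2) *
        (T ℝ (k : ℤ)).eval x =
        1 / 2 * ∑ j ∈ Finset.Icc (-s : ℤ) s, b j ^ 2 * ((T ℝ j).eval x * (T ℝ (j + k)).eval x) +
        1 / 2 * ∑ j ∈ Finset.Icc (-s : ℤ) s,
          b j ^ 2 * ((T ℝ j).eval x * (T ℝ (j - k)).eval x) := by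
      rw [Finset.sum_mul, Finset.mul_sum, Finset.mul_sum, ← Finset.sum_add_distrib]
      refine Finset.sum_congr rfl fun j _ => ?_
      linear_combination (1 / 2 * b j ^ 2 * (T ℝ j).eval x) * hTT j k
    rw [e2, e1]
    ring
  have h2 : ∑ j ∈ Finset.Icc (-s - k : ℤ) s,
      b (j + k) ^ 2 * ((T ℝ j).eval x * (T ℝ (j + k)).eval x) =
      ∑ j ∈ Finset.Icc (-s - k : ℤ) s, b j ^ 2 * ((T ℝ j).eval x * (T ℝ (j + k)).eval x) := by
    rw [← sum_Icc_neg_sub]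
    refine Finset.sum_congr rfl fun j _ => ?_
    rw [show -(k : ℤ) - j + k = -j by ring, show -(k : ℤ) - j = -(j + k) by ring, T_neg, T_neg,
      heven]
    ring
  rw [h1, chebMean_T_mul_kerPoly_sq heven hb, hext _ (fun j hj => by rw [hj]; ring),
    hext _ (fun j hj => by rw [hj]; ring), ← sub_eq_zero]
  have h3 : ∀ j : ℤ, 1 / 2 * (b j - b (j + k)) ^ 2 * ((T ℝ j).eval x * (T ℝ (j + k)).eval x) =
      1 / 2 * (b j ^ 2 * ((T ℝ j).eval x * (T ℝ (j + k)).eval x)) +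
      1 / 2 * (b (j + k) ^ 2 * ((T ℝ j).eval x * (T ℝ (j + k)).eval x)) -
      b j * (T ℝ j).eval x * (b (j + k) * (T ℝ (j + k)).eval x) := fun j => by ring
  simp_rw [h3]
  rw [Finset.sum_sub_distrib, Finset.sum_add_distrib, ← Finset.mul_sum, ← Finset.mul_sum, h2]
  ring

/-- The image of `q` under the univariate squared-kernel operator, through Gauss quadrature. -/
def kerMoment (b : ℤ → ℝ) (s Q : ℕ) (q : ℝ[X]) : ℝ[X] :=
  ∑ i : Fin Q, C ((Q : ℝ)⁻¹ * q.eval (chebNode Q i)) * kerPoly b s (chebNode Q i) ^ 2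

theorem eval_kerMoment (hb : ∀ j : ℤ, s ≤ j.natAbs → b j = 0) {Q : ℕ} {q : ℝ[X]}
    (hQ : q.natDegree + 2 * (s - 1) < 2 * Q) (x : ℝ) :
    (kerMoment b s Q q).eval x = chebMean (q * kerPoly b s x ^ 2) := by
  rw [chebMean_eq_sum_chebNode (Q := Q), kerMoment, eval_finsetSum]
  · refine Finset.sum_congr rfl fun i _ => ?_
    rw [eval_mul, eval_C, eval_pow, eval_mul, eval_pow, eval_kerPoly_comm]
    ring
  · have h1 : (kerPoly b s x ^ 2).natDegree ≤ 2 * (s - 1) :=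
      natDegree_pow_le.trans (Nat.mul_le_mul_left 2 (natDegree_kerPoly_le hb x))
    have := natDegree_mul_le (p := q) (q := kerPoly b s x ^ 2)
    omega

theorem sum_mul_T_sub_kerMoment (heven : ∀ j, b (-j) = b j)
    (hb : ∀ j : ℤ, s ≤ j.natAbs → b j = 0) (k Q : ℕ) (hQ : k + 2 * (s - 1) < 2 * Q) :
    (∑ j ∈ Finset.Icc (-s : ℤ) s, C (b j ^ 2) * T ℝ j ^ 2) * T ℝ (k : ℤ) -
      kerMoment b s Q (T ℝ (k : ℤ)) =
    ∑ j ∈ Finset.Icc (-s - k : ℤ) s, (1 / 2 * (b j - b (j + k)) ^ 2) •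
      (T ℝ j * T ℝ (j + k)) := by
  refine Polynomial.funext fun x => ?_
  rw [eval_sub, eval_kerMoment hb (by simpa using hQ), eval_mul, eval_finsetSum, eval_finsetSum]
  simp only [eval_mul, eval_C, eval_pow, eval_smul, smul_eq_mul]
  exact sum_mul_eval_T_sub_chebMean heven hb k x

theorem coordNorm_sum_mul_T_sub_kerMoment_le (heven : ∀ j, b (-j) = b j)
    (hb : ∀ j : ℤ, s ≤ j.natAbs → b j = 0) (k Q : ℕ) (hQ : k + 2 * (s - 1) < 2 * Q) {δ : ℝ}
    (hδ : ∀ j, |b j - b (j + k)| ≤ δ) :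
    coordNorm uniBasis ((∑ j ∈ Finset.Icc (-s : ℤ) s, C (b j ^ 2) * T ℝ j ^ 2) * T ℝ (k : ℤ) -
      kerMoment b s Q (T ℝ (k : ℤ))) ≤ (2 * s + k + 1) * (1 / 2 * δ ^ 2) := by
  rw [sum_mul_T_sub_kerMoment heven hb k Q hQ]
  have hterm : ∀ j : ℤ, coordNorm uniBasis ((1 / 2 * (b j - b (j + k)) ^ 2) •
      (T ℝ j * T ℝ (j + k))) ≤ 1 / 2 * δ ^ 2 := fun j => by
    rw [coordNorm_smul, abs_of_nonneg (by positivity)]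
    have h1 : (b j - b (j + k)) ^ 2 ≤ δ ^ 2 := by
      rw [← sq_abs]; exact pow_le_pow_left₀ (abs_nonneg _) (hδ j) 2
    have h2 := coordNorm_T_mul_T_le j (j + k)
    have h3 := coordNorm_nonneg uniBasis (T ℝ j * T ℝ (j + k))
    nlinarith [sq_nonneg (b j - b (j + k))]
  refine (coordNorm_sum_le _ _ _).trans ((Finset.sum_le_sum fun j _ => hterm j).trans ?_)
  rw [Finset.sum_const, Int.card_Icc, nsmul_eq_mul]
  have : ((s : ℤ) + 1 - (-s - k)).toNat = 2 * s + k + 1 := by omega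
  rw [this]
  push_cast
  rfl

end Moments

/-! ### The Fejér weights -/

/-- The Fejér weights `max (1 - |j| / s) 0`, indexed by the integers. -/
def fejerWeight (s : ℕ) (j : ℤ) : ℝ := max (1 - |(j : ℝ)| / s) 0

theorem fejerWeight_neg (s : ℕ) (j : ℤ) : fejerWeight s (-j) = fejerWeight s j := by
  simp [fejerWeight]

theorem fejerWeight_zero (s : ℕ) : fejerWeight s 0 = 1 := by simp [fejerWeight]

theorem fejerWeight_eq_zero {s : ℕ} (hs : 1 ≤ s) (j : ℤ) (hj : s ≤ j.natAbs) :
    fejerWeight s j = 0 := by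
  have hs0 : (0 : ℝ) < s := by exact_mod_cast hs
  have h : (s : ℝ) ≤ |(j : ℝ)| := by
    rw [← Int.cast_abs, ← Int.natCast_natAbs]
    exact_mod_cast hj
  refine max_eq_right ?_
  rw [sub_nonpos, one_le_div hs0]
  exact h

theorem abs_fejerWeight_sub_le (s : ℕ) (j : ℤ) (k : ℕ) :
    |fejerWeight s j - fejerWeight s (j + k)| ≤ k / s := by
  have h1 : |(|((j + k : ℤ) : ℝ)| - |(j : ℝ)|)| ≤ k := by
    refine (abs_abs_sub_abs_le_abs_sub _ _).trans ?_
    push_cast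
    rw [add_sub_cancel_left, Nat.abs_cast]
  refine (abs_max_sub_max_le_abs _ _ _).trans ?_
  rw [sub_sub_sub_cancel_left, ← sub_div, abs_div, Nat.abs_cast]
  exact div_le_div_of_nonneg_right h1 (Nat.cast_nonneg _)

theorem fejerWeight_natCast {s j : ℕ} (hs : 1 ≤ s) (hj : j ≤ s) :
    fejerWeight s j = 1 - fejer s j := by
  have hs0 : (0 : ℝ) < s := by exact_mod_cast hs
  rw [fejer, if_pos hj, fejerWeight, Int.cast_natCast, Nat.abs_cast]
  refine max_eq_left ?_
  rw [sub_nonneg, div_le_one hs0]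
  exact_mod_cast hj

theorem kerS_fejer {s : ℕ} (hs : 1 ≤ s) (x y : ℝ) :
    kerS (fejer s) s x y = (kerPoly (fejerWeight s) s y).eval x := by
  rw [eval_kerPoly, sum_Icc_neg_of_even, kerS]
  · simp only [fejerWeight_zero, T_zero, eval_one, mul_one]
    congr 2
    refine Finset.sum_congr rfl fun j hj => ?_
    rw [fejerWeight_natCast hs (Finset.mem_Icc.mp hj).2]
    ring
  · intro j
    rw [fejerWeight_neg, T_neg]

theorem kerC_fejer {s : ℕ} (hs : 1 ≤ s) :
    kerC (fejer s) s = ∑ j ∈ Finset.Icc (-s : ℤ) s, fejerWeight s j ^ 2 := by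
  rw [sum_Icc_neg_of_even, kerC]
  · simp only [fejerWeight_zero, one_pow]
    congr 2
    refine Finset.sum_congr rfl fun j hj => ?_
    rw [fejerWeight_natCast hs (Finset.mem_Icc.mp hj).2]
  · intro j
    rw [fejerWeight_neg]

theorem kerM_fejer {s : ℕ} (hs : 1 ≤ s) :
    kerM (fejer s) s = ∑ j ∈ Finset.Icc (-s : ℤ) s, C (fejerWeight s j ^ 2) * T ℝ j ^ 2 := by
  refine Polynomial.funext fun x => ?_
  simp only [kerM, eval_add, eval_one, eval_mul, eval_ofNat, eval_finsetSum, eval_C, eval_pow]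
  rw [sum_Icc_neg_of_even]
  · simp only [fejerWeight_zero, one_pow, T_zero, eval_one, mul_one]
    congr 2
    refine Finset.sum_congr rfl fun j hj => ?_
    rw [fejerWeight_natCast hs (Finset.mem_Icc.mp hj).2]
  · intro j
    rw [fejerWeight_neg, T_neg]

theorem natDegree_kerM_fejer_le {s : ℕ} (hs : 1 ≤ s) :
    (kerM (fejer s) s).natDegree ≤ 2 * (s - 1) := by
  rw [kerM_fejer hs]
  refine natDegree_sum_le_of_forall_le _ _ fun j _ => ?_
  by_cases hj : s ≤ j.natAbs
  · simp [fejerWeight_eq_zero hs j hj]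
  · refine (natDegree_C_mul_le _ _).trans (natDegree_pow_le.trans ?_)
    rw [natDegree_T]
    omega

/-! ### Positivity of the cosine sums -/

/-- The Fejér sum `m + 2 ∑ (m - j) cos (j θ)`. -/
def fejerSum (m : ℕ) (θ : ℝ) : ℝ :=
  m + 2 * ∑ j ∈ Finset.range m, ((m : ℝ) - (j + 1)) * Real.cos ((j + 1) * θ)

/-- The quadratic Fejér sum `s² + 2 ∑ (s - j)² cos (j θ)`. -/
def sqFejerSum (s : ℕ) (θ : ℝ) : ℝ :=
  s ^ 2 + 2 * ∑ j ∈ Finset.range s, ((s : ℝ) - (j + 1)) ^ 2 * Real.cos ((j + 1) * θ)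

theorem fejerSum_succ (m : ℕ) (θ : ℝ) : fejerSum (m + 1) θ =
    fejerSum m θ + (1 + 2 * ∑ j ∈ Finset.range m, Real.cos ((j + 1) * θ)) := by
  rw [fejerSum, fejerSum, Finset.sum_range_succ]
  have : ∑ j ∈ Finset.range m, (((m + 1 : ℕ) : ℝ) - (j + 1)) * Real.cos ((j + 1) * θ) =
      ∑ j ∈ Finset.range m, ((m : ℝ) - (j + 1)) * Real.cos ((j + 1) * θ) +
      ∑ j ∈ Finset.range m, Real.cos ((j + 1) * θ) := by
    rw [← Finset.sum_add_distrib]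
    exact Finset.sum_congr rfl fun j _ => by push_cast; ring
  rw [this]
  push_cast
  ring

theorem fejerSum_eq (m : ℕ) (θ : ℝ) : fejerSum m θ =
    (∑ l ∈ Finset.range m, Real.cos (l * θ)) ^ 2 + (∑ l ∈ Finset.range m, Real.sin (l * θ)) ^ 2 := by
  induction m with
  | zero => simp [fejerSum]
  | succ m ih =>
    rw [fejerSum_succ, ih, Finset.sum_range_succ _ m, Finset.sum_range_succ _ m]
    have : ∑ j ∈ Finset.range m, Real.cos ((j + 1) * θ) =
        Real.cos (m * θ) * ∑ l ∈ Finset.range m, Real.cos (l * θ) +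
        Real.sin (m * θ) * ∑ l ∈ Finset.range m, Real.sin (l * θ) := by
      rw [← Finset.sum_range_reflect, Finset.mul_sum, Finset.mul_sum, ← Finset.sum_add_distrib]
      refine Finset.sum_congr rfl fun l hl => ?_
      rw [← Real.cos_sub]
      have h : m - 1 - l + 1 + l = m := by have := Finset.mem_range.mp hl; omega
      have h' : ((m - 1 - l : ℕ) : ℝ) + 1 + l = m := by exact_mod_cast h
      congr 1
      linear_combination θ * h'
    rw [this]
    linear_combination -(Real.sin_sq_add_cos_sq (m * θ))

theorem fejerSum_nonneg (m : ℕ) (θ : ℝ) : 0 ≤ fejerSum m θ := by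
  rw [fejerSum_eq]; positivity

theorem sqFejerSum_succ (s : ℕ) (θ : ℝ) :
    sqFejerSum (s + 1) θ = sqFejerSum s θ + (fejerSum (s + 1) θ + fejerSum s θ) := by
  rw [fejerSum_succ, sqFejerSum, sqFejerSum, fejerSum, Finset.sum_range_succ]
  have : ∑ j ∈ Finset.range s, (((s + 1 : ℕ) : ℝ) - (j + 1)) ^ 2 * Real.cos ((j + 1) * θ) =
      ∑ j ∈ Finset.range s, ((s : ℝ) - (j + 1)) ^ 2 * Real.cos ((j + 1) * θ) +
      (2 * ∑ j ∈ Finset.range s, ((s : ℝ) - (j + 1)) * Real.cos ((j + 1) * θ) +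
      ∑ j ∈ Finset.range s, Real.cos ((j + 1) * θ)) := by
    rw [Finset.mul_sum, ← Finset.sum_add_distrib, ← Finset.sum_add_distrib]
    exact Finset.sum_congr rfl fun j _ => by push_cast; ring
  rw [this]
  push_cast
  ring

theorem sqFejerSum_nonneg (s : ℕ) (θ : ℝ) : 0 ≤ sqFejerSum s θ := by
  induction s with
  | zero => simp [sqFejerSum]
  | succ s ih =>
    rw [sqFejerSum_succ]
    linarith [fejerSum_nonneg s θ, fejerSum_nonneg (s + 1) θ]

theorem le_sqFejerSum_zero (s : ℕ) : 2 / 3 * (s : ℝ) ^ 3 ≤ sqFejerSum s 0 := by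
  have h (m : ℕ) : fejerSum m 0 = m ^ 2 := by simp [fejerSum_eq]
  induction s with
  | zero => simp [sqFejerSum]
  | succ s ih =>
    rw [sqFejerSum_succ, h, h]
    push_cast
    nlinarith

theorem one_add_two_mul_sum_fejer {s : ℕ} (hs : 1 ≤ s) (θ : ℝ) :
    1 + 2 * ∑ j ∈ Finset.Icc 1 s, (1 - fejer s j) ^ 2 * Real.cos (j * θ) =
      sqFejerSum s θ / s ^ 2 := by
  have hs0 : (s : ℝ) ≠ 0 := by positivity
  rw [sqFejerSum, ← Finset.Ico_add_one_right_eq_Icc, Finset.sum_Ico_eq_sum_range, add_div,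
    div_self (by positivity), mul_div_assoc, Finset.sum_div]
  congr 2
  refine Finset.sum_congr (by simp) fun j hj => ?_
  have hj' := Finset.mem_range.mp hj
  rw [fejer, if_pos (by omega)]
  push_cast
  rw [add_comm (1 : ℝ) j]
  field_simp

theorem kerC_fejer_ge {s : ℕ} (hs : 1 ≤ s) : 2 / 3 * (s : ℝ) ≤ kerC (fejer s) s := by
  have h := one_add_two_mul_sum_fejer hs 0
  simp only [mul_zero, Real.cos_zero, mul_one] at h
  have hs0 : (0 : ℝ) < s := by positivity
  rw [kerC, h, le_div_iff₀ (by positivity)]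
  linarith [le_sqFejerSum_zero s]

theorem kerC_fejer_pos {s : ℕ} (hs : 1 ≤ s) : 0 < kerC (fejer s) s :=
  lt_of_lt_of_le (by positivity) (kerC_fejer_ge hs)

theorem eval_kerM_le {a : ℕ → ℝ} {s : ℕ} {x : ℝ} (hx : x ∈ Set.Icc (-1 : ℝ) 1) :
    (kerM a s).eval x ≤ kerC a s := by
  simp only [kerM, kerC, eval_add, eval_one, eval_mul, eval_ofNat, eval_finsetSum, eval_C, eval_pow]
  gcongr with j _
  refine mul_le_of_le_one_right (sq_nonneg _) ?_
  rw [sq_le_one_iff_abs_le_one]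
  exact abs_eval_T_le_one _ hx

theorem half_kerC_le_eval_kerM {s : ℕ} (hs : 1 ≤ s) {x : ℝ} (hx : x ∈ Set.Icc (-1 : ℝ) 1) :
    kerC (fejer s) s / 2 ≤ (kerM (fejer s) s).eval x := by
  have h := one_add_two_mul_sum_fejer hs (2 * Real.arccos x)
  have h1 : 0 ≤ sqFejerSum s (2 * Real.arccos x) / s ^ 2 :=
    div_nonneg (sqFejerSum_nonneg _ _) (by positivity)
  have h2 : (kerM (fejer s) s).eval x = 1 / 2 * kerC (fejer s) s + 1 / 2 *
      (1 + 2 * ∑ j ∈ Finset.Icc 1 s,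
        (1 - fejer s j) ^ 2 * Real.cos (j * (2 * Real.arccos x))) := by
    simp only [kerM, kerC, eval_add, eval_one, eval_mul, eval_ofNat, eval_finsetSum, eval_C,
      eval_pow]
    have : ∀ j : ℕ, (1 - fejer s j) ^ 2 * (T ℝ (j : ℤ)).eval x ^ 2 =
        1 / 2 * (1 - fejer s j) ^ 2 +
        1 / 2 * ((1 - fejer s j) ^ 2 * Real.cos (j * (2 * Real.arccos x))) := fun j => by
      conv_lhs => rw [← Real.cos_arccos hx.1 hx.2, T_real_cos, Int.cast_natCast]
      rw [Real.cos_sq, mul_left_comm (j : ℝ)]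
      ring
    simp_rw [this, Finset.sum_add_distrib, ← Finset.mul_sum]
    ring
  rw [h2, h]
  linarith

/-! ### The truncated geometric series -/

/-- The polynomial `1 - M / C`. -/
def kerDefect (s : ℕ) : ℝ[X] := 1 - C (kerC (fejer s) s)⁻¹ * kerM (fejer s) s

theorem abs_eval_kerDefect_le {s : ℕ} (hs : 1 ≤ s) {x : ℝ} (hx : x ∈ Set.Icc (-1 : ℝ) 1) :
    |(kerDefect s).eval x| ≤ 1 / 2 := by
  have hC := kerC_fejer_pos hs
  have h1 := eval_kerM_le (a := fejer s) (s := s) hx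
  have h2 := half_kerC_le_eval_kerM hs hx
  simp only [kerDefect, eval_sub, eval_one, eval_mul, eval_C]
  rw [inv_mul_eq_div]
  have h3 : (kerM (fejer s) s).eval x / kerC (fejer s) s ≤ 1 := (div_le_one hC).mpr h1
  have h4 : 1 / 2 ≤ (kerM (fejer s) s).eval x / kerC (fejer s) s := by
    rw [le_div_iff₀ hC]; linarith
  rw [abs_le]
  constructor <;> linarith

theorem natDegree_kerDefect_le {s : ℕ} (hs : 1 ≤ s) : (kerDefect s).natDegree ≤ 2 * (s - 1) := by
  refine (natDegree_sub_le _ _).trans (max_le (by simp) ?_)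
  exact (natDegree_C_mul_le _ _).trans (natDegree_kerM_fejer_le hs)

theorem kerDefect_one : kerDefect 1 = 0 := by
  simp [kerDefect, kerM, kerC, fejer]

theorem coordNorm_kerDefect_le {s : ℕ} (hs : 1 ≤ s) : coordNorm uniBasis (kerDefect s) ≤ 1 := by
  have hC := kerC_fejer_pos hs
  have h1 : kerDefect s = (kerC (fejer s) s)⁻¹ •
      ∑ j ∈ Finset.Icc (-s : ℤ) s, fejerWeight s j ^ 2 • (1 - T ℝ j ^ 2) := by
    have h : ∑ j ∈ Finset.Icc (-s : ℤ) s, fejerWeight s j ^ 2 • (1 - T ℝ j ^ 2) =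
        C (kerC (fejer s) s) - kerM (fejer s) s := by
      rw [kerC_fejer hs, kerM_fejer hs, map_sum, ← Finset.sum_sub_distrib]
      refine Finset.sum_congr rfl fun j _ => ?_
      rw [smul_eq_C_mul, mul_sub, mul_one]
    rw [h, smul_eq_C_mul, mul_sub, ← map_mul, inv_mul_cancel₀ hC.ne', map_one, kerDefect]
  have h2 : ∀ j : ℤ, coordNorm uniBasis (1 - T ℝ j ^ 2) ≤ 1 := fun j => by
    have e : 1 - T ℝ j ^ 2 = (1 / 2 : ℝ) • T ℝ 0 + (-1 / 2 : ℝ) • T ℝ (2 * j) := by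
      have e2 : (T ℝ 0 : ℝ[X]) = (1 / 2 : ℝ) • T ℝ 0 + (1 / 2 : ℝ) • T ℝ 0 := by
        rw [← add_smul]; norm_num
      rw [pow_two, T_mul_T_eq, sub_self, ← two_mul, ← T_zero ℝ, smul_add]
      nth_rw 1 [e2]
      rw [neg_div, neg_smul]
      abel
    rw [e]
    refine (coordNorm_add_le _ _ _).trans ?_
    rw [coordNorm_smul, coordNorm_smul, coordNorm_T, coordNorm_T]
    norm_num [abs_of_pos, abs_of_neg]
  rw [h1, coordNorm_smul, abs_of_pos (inv_pos.mpr hC), inv_mul_le_iff₀ hC, mul_one, kerC_fejer hs]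
  refine (coordNorm_sum_le _ _ _).trans (Finset.sum_le_sum fun j _ => ?_)
  rw [coordNorm_smul, abs_of_nonneg (sq_nonneg _)]
  exact mul_le_of_le_one_right (sq_nonneg _) (h2 j)

theorem geomTrunc_fejer (s N : ℕ) : geomTrunc (fejer s) s N =
    (kerC (fejer s) s)⁻¹ • ∑ m ∈ Finset.range (N + 1), kerDefect s ^ m := by
  rw [geomTrunc, smul_eq_C_mul]
  rfl

theorem coordNorm_geomTrunc_le {s : ℕ} (hs : 1 ≤ s) (N : ℕ) :
    coordNorm uniBasis (geomTrunc (fejer s) s N) ≤ (N + 1) / kerC (fejer s) s := by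
  have hC := kerC_fejer_pos hs
  rw [geomTrunc_fejer, coordNorm_smul, abs_of_pos (inv_pos.mpr hC), div_eq_inv_mul]
  refine mul_le_mul_of_nonneg_left ?_ (inv_pos.mpr hC).le
  refine (coordNorm_sum_le _ _ _).trans ((Finset.sum_le_sum fun m _ =>
    coordNorm_pow_le_one (coordNorm_kerDefect_le hs) m).trans ?_)
  simp

theorem geomTrunc_mul_kerM (s N : ℕ) :
    geomTrunc (fejer s) s N * kerM (fejer s) s = 1 - kerDefect s ^ (N + 1) := by
  have h : (C (kerC (fejer s) s)⁻¹ * kerM (fejer s) s : ℝ[X]) = 1 - kerDefect s := by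
    rw [kerDefect, sub_sub_cancel]
  rw [geomTrunc_fejer, smul_eq_C_mul, mul_right_comm, h, mul_neg_geom_sum]

theorem natDegree_geomTrunc_le {s : ℕ} (hs : 1 ≤ s) (N : ℕ) :
    (geomTrunc (fejer s) s N).natDegree ≤ N * (2 * (s - 1)) := by
  rw [geomTrunc_fejer]
  refine (natDegree_smul_le _ _).trans (natDegree_sum_le_of_forall_le _ _ fun m hm => ?_)
  exact natDegree_pow_le.trans (Nat.mul_le_mul (Nat.lt_succ_iff.mp (Finset.mem_range.mp hm))
    (natDegree_kerDefect_le hs))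

theorem isSumSq_C {c : ℝ} (hc : 0 ≤ c) : IsSumSq (C c : ℝ[X]) := by
  rw [← Real.mul_self_sqrt hc, map_mul]
  exact IsSumSq.mul_self _

theorem two_mul_geom_sum {R : Type*} [CommRing R] (t : R) (k : ℕ) :
    2 * ∑ m ∈ Finset.range (2 * k + 1), t ^ m =
      1 + t ^ k * t ^ k + ∑ j ∈ Finset.range k, (t ^ j + t ^ (j + 1)) ^ 2 := by
  induction k with
  | zero => norm_num
  | succ k ih =>
    rw [show 2 * (k + 1) + 1 = 2 * k + 1 + 1 + 1 by ring, Finset.sum_range_succ,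
      Finset.sum_range_succ, mul_add, mul_add, ih, Finset.sum_range_succ]
    ring

theorem isSumSq_geomTrunc {s : ℕ} (hs : 1 ≤ s) {N : ℕ} (hN : Even N) :
    IsSumSq (geomTrunc (fejer s) s N) := by
  have hC := kerC_fejer_pos hs
  obtain ⟨k, rfl⟩ := hN
  have h : geomTrunc (fejer s) s (k + k) = C ((kerC (fejer s) s)⁻¹ * (1 / 2)) *
      (1 + kerDefect s ^ k * kerDefect s ^ k +
        ∑ j ∈ Finset.range k, (kerDefect s ^ j + kerDefect s ^ (j + 1)) ^ 2) := by
    rw [← two_mul_geom_sum, geomTrunc_fejer, smul_eq_C_mul, ← two_mul k, map_mul, mul_assoc]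
    congr 1
    rw [← mul_assoc, ← map_ofNat (C : ℝ →+* ℝ[X]) 2, ← map_mul]
    norm_num
  rw [h]
  exact (isSumSq_C (by positivity)).mul
    ((IsSumSq.one.add (IsSumSq.mul_self _)).add (IsSumSq.sum_sq _ _))

theorem coordNorm_geomTrunc_mul_kerMoment_sub_le {s : ℕ} (hs : 1 ≤ s) (N : ℕ) {k Q : ℕ}
    (hk : k ≤ s) (hQ : k + 2 * (s - 1) < 2 * Q) :
    coordNorm uniBasis (geomTrunc (fejer s) s N * kerMoment (fejerWeight s) s Q (T ℝ (k : ℤ)) -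
      T ℝ (k : ℤ)) ≤
      3 * (N + 1) * k ^ 2 / s ^ 2 + coordNorm uniBasis (kerDefect s ^ (N + 1)) := by
  have hs0 : (0 : ℝ) < s := by exact_mod_cast hs
  have hC := kerC_fejer_pos hs
  have hdefect := coordNorm_sum_mul_T_sub_kerMoment_le (fejerWeight_neg s) (fejerWeight_eq_zero hs)
    k Q hQ (fun j => abs_fejerWeight_sub_le s j k)
  rw [← kerM_fejer hs] at hdefect
  set q := kerMoment (fejerWeight s) s Q (T ℝ (k : ℤ))
  set M := kerM (fejer s) s
  set G := geomTrunc (fejer s) s N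
  have h1 : G * q - T ℝ (k : ℤ) = (-1 : ℝ) • (G * (M * T ℝ (k : ℤ) - q)) +
      (-1 : ℝ) • (kerDefect s ^ (N + 1) * T ℝ (k : ℤ)) := by
    have := geomTrunc_mul_kerM s N
    rw [neg_one_smul, neg_one_smul]
    linear_combination (T ℝ (k : ℤ)) * this
  rw [h1]
  refine (coordNorm_add_le _ _ _).trans (add_le_add ?_ ?_)
  · rw [coordNorm_smul, abs_neg, abs_one, one_mul]
    refine (coordNorm_mul_le _ _).trans ((mul_le_mul (coordNorm_geomTrunc_le hs N) hdefect
      (coordNorm_nonneg _ _) (by positivity)).trans ?_)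
    have hge := kerC_fejer_ge hs
    have hks : (k : ℝ) ≤ s := by exact_mod_cast hk
    have hs1 : (1 : ℝ) ≤ s := by exact_mod_cast hs
    calc ((N : ℝ) + 1) / kerC (fejer s) s * ((2 * s + k + 1) * (1 / 2 * (k / s : ℝ) ^ 2))
        ≤ ((N : ℝ) + 1) / (2 / 3 * s) * ((4 * s) * (1 / 2 * (k / s : ℝ) ^ 2)) := by
          gcongr
          linarith
      _ = 3 * ((N : ℝ) + 1) * (k : ℝ) ^ 2 / (s : ℝ) ^ 2 := by
          field_simp
          ring
  · rw [coordNorm_smul, abs_neg, abs_one, one_mul]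
    refine (coordNorm_mul_le _ _).trans ?_
    rw [coordNorm_T, mul_one]

theorem coordNorm_kerDefect_pow_le {s : ℕ} (hs : 1 ≤ s) (m : ℕ) :
    coordNorm uniBasis (kerDefect s ^ m) ≤ 2 * (m * (2 * (s - 1)) + 1) * (1 / 2) ^ m := by
  have hdeg : (kerDefect s ^ m).natDegree ≤ m * (2 * (s - 1)) :=
    natDegree_pow_le.trans (Nat.mul_le_mul_left m (natDegree_kerDefect_le hs))
  have hdeg' : ((kerDefect s ^ m).natDegree : ℝ) ≤ m * (2 * (s - 1)) := by
    calc ((kerDefect s ^ m).natDegree : ℝ) ≤ (m * (2 * (s - 1)) : ℕ) := by exact_mod_cast hdeg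
      _ = m * (2 * (s - 1)) := by push_cast [Nat.cast_sub hs]; ring
  refine (coordNorm_le_of_abs_le (B := (1 / 2) ^ m) fun x hx => ?_).trans (by gcongr)
  rw [eval_pow, abs_pow]
  exact pow_le_pow_left₀ (abs_nonneg _) (abs_eval_kerDefect_le hs hx) m

/-! ### The multivariate operator -/

/-- The squared-kernel operator on polynomials, through tensor Gauss quadrature. -/
def kerOpPoly (n : ℕ) (b : ℤ → ℝ) (s Q : ℕ) :
    MvPolynomial (Fin n) ℝ →ₗ[ℝ] MvPolynomial (Fin n) ℝ where
  toFun f := ∑ v : Fin n → Fin Q,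
    ((∏ _i : Fin n, (Q : ℝ)⁻¹) * MvPolynomial.eval (fun i => chebNode Q (v i)) f) •
      ∏ i, inVar i (kerPoly b s (chebNode Q (v i)) ^ 2)
  map_add' f g := by
    simp_rw [map_add, mul_add, add_smul, Finset.sum_add_distrib]
  map_smul' c f := by
    simp_rw [MvPolynomial.smul_eval, Finset.smul_sum, smul_smul, RingHom.id_apply,
      mul_left_comm c]

theorem kerOpPoly_apply {n : ℕ} (b : ℤ → ℝ) (s Q : ℕ) (f : MvPolynomial (Fin n) ℝ) :
    kerOpPoly n b s Q f = ∑ v : Fin n → Fin Q,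
      ((∏ _i : Fin n, (Q : ℝ)⁻¹) * MvPolynomial.eval (fun i => chebNode Q (v i)) f) •
        ∏ i, inVar i (kerPoly b s (chebNode Q (v i)) ^ 2) := rfl

theorem eval_chebT {n : ℕ} (α : Fin n →₀ ℕ) (x : Fin n → ℝ) :
    MvPolynomial.eval x (chebT α) = ∏ i, (T ℝ (α i : ℤ)).eval (x i) := by
  rw [chebT, map_prod]
  exact Finset.prod_congr rfl fun i _ => eval_inVar i _ x

theorem kerOpPoly_chebT {n : ℕ} (b : ℤ → ℝ) (s Q : ℕ) (α : Fin n →₀ ℕ) :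
    kerOpPoly n b s Q (chebT α) = ∏ i, inVar i (kerMoment b s Q (T ℝ (α i : ℤ))) := by
  have h : ∀ i : Fin n, inVar i (kerMoment b s Q (T ℝ (α i : ℤ))) = ∑ j : Fin Q,
      ((Q : ℝ)⁻¹ * (T ℝ (α i : ℤ)).eval (chebNode Q j)) •
        inVar i (kerPoly b s (chebNode Q j) ^ 2) := fun i => by
    simp_rw [inVar, kerMoment, map_sum, ← smul_eq_C_mul, map_smul]
  simp_rw [h]
  rw [Finset.prod_univ_sum, Fintype.piFinset_univ, kerOpPoly_apply]
  refine Finset.sum_congr rfl fun v _ => ?_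
  rw [Finset.prod_smul, Finset.prod_mul_distrib, eval_chebT]

theorem IsSumSq.map_algHom {A B : Type*} [CommSemiring A] [CommSemiring B] [Algebra ℝ A]
    [Algebra ℝ B] (φ : A →ₐ[ℝ] B) {a : A} (ha : IsSumSq a) : IsSumSq (φ a) := by
  induction ha with
  | zero => rw [map_zero]; exact IsSumSq.zero
  | sq_add a _ ih => rw [map_add, map_mul]; exact (IsSumSq.mul_self _).add ih

theorem isSumSq_kerOpPoly {n : ℕ} (b : ℤ → ℝ) (s Q : ℕ) {f : MvPolynomial (Fin n) ℝ}
    (hf : ∀ x ∈ cube n, 0 ≤ MvPolynomial.eval x f) : IsSumSq (kerOpPoly n b s Q f) := by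
  rw [kerOpPoly_apply]
  refine IsSumSq.sum fun v _ => ?_
  have h0 : 0 ≤ (∏ _i : Fin n, (Q : ℝ)⁻¹) *
      MvPolynomial.eval (fun i => chebNode Q (v i)) f :=
    mul_nonneg (Finset.prod_nonneg fun _ _ => by positivity)
      (hf _ fun i _ => chebNode_mem Q (v i))
  rw [MvPolynomial.smul_eq_C_mul, ← Real.mul_self_sqrt h0, map_mul]
  refine (IsSumSq.mul_self _).mul (IsSumSq.prod fun i _ => ?_)
  rw [inVar, pow_two, map_mul]
  exact IsSumSq.mul_self _

theorem totalDegree_prod_inVar_le {n m : ℕ} {q : Fin n → ℝ[X]} (hq : ∀ i, (q i).natDegree ≤ m) :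
    (∏ i, inVar i (q i)).totalDegree ≤ n * m := by
  refine (MvPolynomial.totalDegree_finsetProd _ _).trans ?_
  refine (Finset.sum_le_sum fun i _ => (totalDegree_inVar_le i (q i)).trans (hq i)).trans ?_
  simp

theorem totalDegree_kerOpPoly_le {n : ℕ} {b : ℤ → ℝ} {s : ℕ}
    (hb : ∀ j : ℤ, s ≤ j.natAbs → b j = 0) (Q : ℕ) (f : MvPolynomial (Fin n) ℝ) :
    (kerOpPoly n b s Q f).totalDegree ≤ n * (2 * (s - 1)) := by
  rw [kerOpPoly_apply]
  refine MvPolynomial.totalDegree_finsetSum_le fun v _ => ?_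
  refine (MvPolynomial.totalDegree_smul_le _ _).trans (totalDegree_prod_inVar_le fun i => ?_)
  exact natDegree_pow_le.trans (Nat.mul_le_mul_left 2 (natDegree_kerPoly_le hb _))

theorem eq_sum_chebT {n : ℕ} (f : MvPolynomial (Fin n) ℝ) :
    f = ∑ α ∈ ((chebBasis n).repr f).support, (chebBasis n).repr f α • chebT α := by
  conv_lhs => rw [← (chebBasis n).linearCombination_repr f]
  rw [Finsupp.linearCombination_apply, Finsupp.sum]
  simp_rw [chebBasis_apply]

theorem integral_eval_T_mul_kerS_sq {s : ℕ} (hs : 1 ≤ s) (k : ℤ) (x : ℝ) :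
    ∫ y, (T ℝ k).eval y * kerS (fejer s) s x y ^ 2 ∂chebMeasure =
      chebMean (T ℝ k * kerPoly (fejerWeight s) s x ^ 2) := by
  rw [chebMean_apply]
  simp_rw [kerS_fejer hs, eval_mul, eval_pow, eval_kerPoly_comm _ _ x]

theorem integrable_eval_T_mul_kerS_sq {s : ℕ} (hs : 1 ≤ s) (k : ℤ) (x : ℝ) :
    Integrable (fun y => (T ℝ k).eval y * kerS (fejer s) s x y ^ 2) chebMeasure := by
  have := integrable_eval_chebMeasure (T ℝ k * kerPoly (fejerWeight s) s x ^ 2)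
  simp_rw [kerS_fejer hs]
  simpa only [eval_mul, eval_pow, ← eval_kerPoly_comm _ _ x] using this

theorem eval_kerOpPoly {n d s Q : ℕ} (hs : 1 ≤ s) (hQ : d + 2 * (s - 1) < 2 * Q)
    {f : MvPolynomial (Fin n) ℝ} (hf : f.totalDegree ≤ d) (x : Fin n → ℝ) :
    MvPolynomial.eval x (kerOpPoly n (fejerWeight s) s Q f) = kerOp (fejer s) s f x := by
  have h1 : ∀ y : Fin n → ℝ, MvPolynomial.eval y f * ∏ i, kerS (fejer s) s (x i) (y i) ^ 2 =
      ∑ α ∈ ((chebBasis n).repr f).support, (chebBasis n).repr f α *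
        ∏ i, ((T ℝ (α i : ℤ)).eval (y i) * kerS (fejer s) s (x i) (y i) ^ 2) := by
    intro y
    conv_lhs => rw [eq_sum_chebT f]
    rw [map_sum, Finset.sum_mul]
    refine Finset.sum_congr rfl fun α _ => ?_
    rw [MvPolynomial.smul_eval, eval_chebT, Finset.prod_mul_distrib, mul_assoc]
  have h2 : ∀ α : Fin n →₀ ℕ, Integrable (fun y : Fin n → ℝ =>
      ∏ i, ((T ℝ (α i : ℤ)).eval (y i) * kerS (fejer s) s (x i) (y i) ^ 2))
      (Measure.pi fun _ : Fin n => chebMeasure) := fun α =>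
    Integrable.fintype_prod (f := fun i y => (T ℝ (α i : ℤ)).eval y *
      kerS (fejer s) s (x i) y ^ 2) fun i => integrable_eval_T_mul_kerS_sq hs _ _
  rw [kerOp]
  simp_rw [h1]
  rw [integral_finsetSum _ fun α _ => (h2 α).const_mul _]
  conv_lhs => rw [eq_sum_chebT f]
  rw [map_sum, map_sum]
  refine Finset.sum_congr rfl fun α hα => ?_
  rw [map_smul, MvPolynomial.smul_eval, kerOpPoly_chebT, map_prod, integral_const_mul,
    integral_fintype_prod_eq_prod (fun i y => (T ℝ (α i : ℤ)).eval y *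
      kerS (fejer s) s (x i) y ^ 2)]
  congr 1
  refine Finset.prod_congr rfl fun i _ => ?_
  have hαi : α i ≤ d :=
    (Finset.single_le_sum (fun _ _ => Nat.zero_le _) (Finset.mem_univ i)).trans
      (sum_le_of_mem_support_repr hf hα)
  rw [integral_eval_T_mul_kerS_sq hs, eval_inVar,
    eval_kerMoment (fejerWeight_eq_zero hs)]
  rw [natDegree_T, Int.natAbs_natCast]
  omega

/-- The approximation of `f`: the squared Fejér kernel operator applied to `f`, times the truncated
geometric series in each variable. -/
def sosApprox (n s N Q : ℕ) (f : MvPolynomial (Fin n) ℝ) : MvPolynomial (Fin n) ℝ :=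
  (∏ i, inVar i (geomTrunc (fejer s) s N)) * kerOpPoly n (fejerWeight s) s Q f

theorem sosApprox_mem_sosCone {n s N Q r : ℕ} (hs : 1 ≤ s) (hN : Even N)
    (hr : 2 * n * (s - 1) * (N + 1) ≤ r) {f : MvPolynomial (Fin n) ℝ}
    (hf : ∀ x ∈ cube n, 0 ≤ MvPolynomial.eval x f) : sosApprox n s N Q f ∈ sosCone n r := by
  refine ⟨(IsSumSq.prod fun i _ => IsSumSq.map_algHom _ (isSumSq_geomTrunc hs hN)).mul
    (isSumSq_kerOpPoly _ _ _ hf), ?_⟩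
  refine (MvPolynomial.totalDegree_mul _ _).trans (le_trans (add_le_add
    (totalDegree_prod_inVar_le fun _ => natDegree_geomTrunc_le hs N)
    (totalDegree_kerOpPoly_le (fejerWeight_eq_zero hs) Q f)) (le_trans (le_of_eq ?_) hr))
  ring

theorem eval_sosApprox {n d s N Q : ℕ} (hs : 1 ≤ s) (hQ : d + 2 * (s - 1) < 2 * Q)
    {f : MvPolynomial (Fin n) ℝ} (hf : f.totalDegree ≤ d) (x : Fin n → ℝ) :
    MvPolynomial.eval x (sosApprox n s N Q f) =
      (∏ i, (geomTrunc (fejer s) s N).eval (x i)) * kerOp (fejer s) s f x := by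
  rw [sosApprox, map_mul, eval_kerOpPoly hs hQ hf, map_prod]
  simp_rw [eval_inVar]

theorem chebNorm_sosApprox_sub_le {n d s N Q : ℕ} (hs : 1 ≤ s) (hd : d ≤ s)
    (hQ : d + 2 * (s - 1) < 2 * Q) {f : MvPolynomial (Fin n) ℝ} (hf : f.totalDegree ≤ d) {η : ℝ}
    (hη : coordNorm uniBasis (kerDefect s ^ (N + 1)) ≤ η) :
    chebNorm (sosApprox n s N Q f - f) ≤
      (Real.exp (3 * (N + 1) * d ^ 2 / s ^ 2 + n * η) - 1) * chebNorm f := by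
  have hmap : sosApprox n s N Q f - f =
      ((LinearMap.mulLeft ℝ (∏ i, inVar i (geomTrunc (fejer s) s N))) ∘ₗ
        kerOpPoly n (fejerWeight s) s Q - LinearMap.id :
          MvPolynomial (Fin n) ℝ →ₗ[ℝ] MvPolynomial (Fin n) ℝ) f := rfl
  rw [hmap, chebNorm_eq_coordNorm, chebNorm_eq_coordNorm f]
  refine coordNorm_map_le _ _ _ _ _ fun α hα => ?_
  have hsum := sum_le_of_mem_support_repr hf hα
  have hαi : ∀ i, α i ≤ d := fun i =>
    (Finset.single_le_sum (fun _ _ => Nat.zero_le _) (Finset.mem_univ i)).trans hsum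
  rw [chebBasis_apply, LinearMap.sub_apply, LinearMap.comp_apply, LinearMap.mulLeft_apply,
    LinearMap.id_apply, kerOpPoly_chebT, ← Finset.prod_mul_distrib, chebT]
  have h1 := chebNorm_prod_add_sub_prod_le (fun i => T ℝ (α i : ℤ))
    (fun i => geomTrunc (fejer s) s N * kerMoment (fejerWeight s) s Q (T ℝ (α i : ℤ)) -
      T ℝ (α i : ℤ)) (fun i => 3 * (N + 1) * (α i) ^ 2 / s ^ 2 + η)
    (fun i => (coordNorm_T _).le) (fun i => (coordNorm_geomTrunc_mul_kerMoment_sub_le hs N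
      ((hαi i).trans hd) (by have := hαi i; omega)).trans (by gcongr))
  simp_rw [add_sub_cancel, inVar, map_mul] at h1
  refine h1.trans (sub_le_sub_right (Real.exp_le_exp.mpr ?_) 1)
  rw [Finset.sum_add_distrib, ← Finset.sum_div, ← Finset.mul_sum, Finset.sum_const,
    Finset.card_univ, Fintype.card_fin, nsmul_eq_mul]
  have h2 : ∑ i, ((α i : ℕ) : ℝ) ^ 2 ≤ (d : ℝ) ^ 2 := by
    have : ∑ i, α i ^ 2 ≤ d ^ 2 := calc
      ∑ i, α i ^ 2 ≤ ∑ i, α i * d := Finset.sum_le_sum fun i _ => by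
          rw [pow_two]; exact Nat.mul_le_mul_left _ (hαi i)
      _ ≤ d ^ 2 := by rw [← Finset.sum_mul, pow_two]; exact Nat.mul_le_mul_right _ hsum
    exact_mod_cast this
  gcongr

/-! ### Choice of the parameters -/

theorem exp_sub_one_le_mul_exp (x : ℝ) : Real.exp x - 1 ≤ x * Real.exp x := by
  have h1 := mul_le_mul_of_nonneg_right (Real.add_one_le_exp (-x)) (Real.exp_pos x).le
  rw [← Real.exp_add, neg_add_cancel, Real.exp_zero] at h1
  linarith

theorem exp_three_le : Real.exp 3 ≤ 21 := by
  have h := Real.exp_one_lt_d9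
  calc Real.exp 3 = Real.exp 1 ^ 3 := by rw [← Real.exp_nat_mul]; norm_num
    _ ≤ 2.7182818286 ^ 3 := pow_le_pow_left₀ (Real.exp_pos 1).le h.le 3
    _ ≤ 21 := by norm_num

theorem exp_sub_one_le_of_le {x t : ℝ} (hx : x ≤ 769 * t) (ht : 0 ≤ t) (ht' : 769 * t ≤ 3) :
    Real.exp x - 1 ≤ 70458 * t := by
  have h1 := Real.exp_le_exp.mpr hx
  have h2 := exp_sub_one_le_mul_exp (769 * t)
  have h3 : 769 * t * Real.exp (769 * t) ≤ 769 * t * 21 :=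
    mul_le_mul_of_nonneg_left ((Real.exp_le_exp.mpr ht').trans exp_three_le) (by positivity)
  linarith

theorem logb_two_sq_le {x : ℝ} (hx : 0 < x) (hL : 9 ≤ Real.logb 2 x) :
    Real.logb 2 x ^ 2 ≤ 2.1 * x := by
  set L := Real.logb 2 x with hLdef
  have hxL : x = Real.exp (L * Real.log 2) := by
    rw [hLdef, Real.logb, div_mul_cancel₀ _ (by positivity), Real.exp_log hx]
  have hlog : 0.6931 ≤ Real.log 2 := by linarith [Real.log_two_gt_d9]
  have h1 := Real.pow_div_factorial_le_exp (L * Real.log 2) (by positivity) 3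
  rw [← hxL] at h1
  have h2 : (L * 0.6931) ^ 3 ≤ (L * Real.log 2) ^ 3 := by gcongr
  norm_num [Nat.factorial] at h1
  have h3 : 9 * L ^ 2 ≤ L ^ 3 := by
    rw [pow_succ L 2, mul_comm]
    exact mul_le_mul_of_nonneg_left hL (sq_nonneg L)
  rw [mul_pow] at h2
  norm_num at h2
  linarith

set_option maxHeartbeats 1000000 in
/-- Existence of `s` and `N` realizing the degree and error bounds. -/
theorem exists_parameters {n d r : ℕ} (hn : 1 ≤ n) (hd : 1 ≤ d) (hr : 2 ≤ r)
    (h : 540 * (n : ℝ) ^ 2 * (d : ℝ) ^ 2 ≤ (r : ℝ) / Real.logb 2 r) :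
    ∃ s N : ℕ, 1 ≤ s ∧ d ≤ s ∧ 2 ≤ N ∧ Even N ∧ 2 * n * (s - 1) * (N + 1) ≤ r ∧
      Real.exp (3 * (N + 1) * d ^ 2 / s ^ 2 +
        n * (2 * ((N + 1 : ℕ) * (2 * (s - 1)) + 1) * (1 / 2) ^ (N + 1))) - 1 ≤
      70458 * (n : ℝ) ^ 3 * (d : ℝ) ^ 2 * (Real.logb 2 r ^ 3 / (r : ℝ) ^ 2) := by
  have hr0 : (0 : ℝ) < r := by positivity
  have hn1 : (1 : ℝ) ≤ n := by exact_mod_cast hn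
  have hd1 : (1 : ℝ) ≤ d := by exact_mod_cast hd
  set L := Real.logb 2 r with hLdef
  have hL1 : 1 ≤ L := by
    rw [hLdef, Real.le_logb_iff_rpow_le one_lt_two hr0, Real.rpow_one]
    exact_mod_cast hr
  have hnd : 1 ≤ (n : ℝ) ^ 2 * (d : ℝ) ^ 2 := one_le_mul_of_one_le_of_one_le
    (one_le_pow₀ hn1) (one_le_pow₀ hd1)
  have hrL : 540 * ((n : ℝ) ^ 2 * (d : ℝ) ^ 2) * L ≤ r := by
    rw [le_div_iff₀ (by linarith)] at h
    linarith
  have hr540 : 540 ≤ (r : ℝ) := by nlinarith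
  have hL9 : 9 ≤ L := by
    rw [hLdef, Real.le_logb_iff_rpow_le one_lt_two hr0, show (2 : ℝ) ^ (9 : ℝ) = 512 by norm_num]
    linarith
  set m := ⌈(3 * L + 1) / 2⌉₊ with hm
  have hm1 : (3 * L + 1) / 2 ≤ m := Nat.le_ceil _
  have hm2 : (m : ℝ) < (3 * L + 1) / 2 + 1 := Nat.ceil_lt_add_one (by linarith)
  set N := 2 * m with hN
  have hNr : (N : ℝ) = 2 * m := by rw [hN]; push_cast; ring
  have hN1 : 3 * L + 2 ≤ (N : ℝ) + 1 := by linarith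
  have hN2 : (N : ℝ) + 1 ≤ 4 * L := by linarith
  have hD : 0 < 2 * n * (N + 1) := by positivity
  set s := r / (2 * n * (N + 1)) + 1 with hs
  have hs_one : 1 ≤ s := Nat.succ_pos _
  have hs1 : (s - 1) * (2 * n * (N + 1)) ≤ r := by
    rw [hs, Nat.add_sub_cancel]
    exact Nat.div_mul_le_self _ _
  have hsr : (r : ℝ) ≤ s * (8 * n * L) := by
    have h1 : r ≤ s * (2 * n * (N + 1)) := by
      rw [hs, mul_comm]
      exact (Nat.lt_mul_div_succ r hD).le
    have h2 : (r : ℝ) ≤ s * (2 * n * (N + 1)) := by exact_mod_cast h1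
    have h3 : (s : ℝ) * (2 * n * (N + 1)) ≤ s * (2 * n * (4 * L)) := by gcongr
    linarith
  have hs0 : (0 : ℝ) < s := by
    rw [hs]; positivity
  have hds : (d : ℝ) ≤ s := by
    have h1 : 540 * ((n : ℝ) ^ 2 * (d : ℝ) ^ 2) * L ≤ s * (8 * n * L) := hrL.trans hsr
    have h2 : (d : ℝ) * (8 * n * L) ≤ 540 * ((n : ℝ) ^ 2 * (d : ℝ) ^ 2) * L := by
      have e1 : (n : ℝ) ≤ n ^ 2 := by nlinarith
      have e2 : (d : ℝ) ≤ d ^ 2 := by nlinarith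
      have e3 : (n : ℝ) * d ≤ n ^ 2 * d ^ 2 := by gcongr
      nlinarith
    exact le_of_mul_le_mul_right (h2.trans h1) (by positivity)
  have hm_one : 1 ≤ m := by
    have : (0 : ℝ) < m := by linarith
    exact_mod_cast this
  refine ⟨s, N, hs_one, by exact_mod_cast hds, by omega, ⟨m, by omega⟩, ?_, ?_⟩
  · calc 2 * n * (s - 1) * (N + 1) = (s - 1) * (2 * n * (N + 1)) := by ring
      _ ≤ r := hs1
  set t := (n : ℝ) ^ 2 * (d : ℝ) ^ 2 * (L ^ 3 / (r : ℝ) ^ 2) with ht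
  have hfirst : 3 * ((N : ℝ) + 1) * d ^ 2 / s ^ 2 ≤ 768 * t := by
    have e1 : 1 / (s : ℝ) ≤ 8 * n * L / r := by
      rw [div_le_div_iff₀ hs0 hr0]
      linarith
    calc 3 * ((N : ℝ) + 1) * d ^ 2 / s ^ 2 = 3 * ((N : ℝ) + 1) * d ^ 2 * (1 / s) ^ 2 := by
          rw [one_div_pow, mul_one_div]
      _ ≤ 3 * (4 * L) * d ^ 2 * (8 * n * L / r) ^ 2 := by gcongr
      _ = 768 * t := by rw [ht]; field_simp; ring
  have hpow : ((1 : ℝ) / 2) ^ (N + 1) ≤ 1 / (4 * r ^ 3) := by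
    rw [one_div_pow]
    refine one_div_le_one_div_of_le (by positivity) ?_
    have e1 : (r : ℝ) = (2 : ℝ) ^ L := (Real.rpow_logb two_pos (by norm_num) hr0).symm
    calc (4 : ℝ) * r ^ 3 = (2 : ℝ) ^ (3 * L + 2) := by
          rw [Real.rpow_add two_pos, mul_comm 3 L, Real.rpow_mul two_pos.le, ← e1]
          norm_num
          ring
      _ ≤ (2 : ℝ) ^ ((N + 1 : ℕ) : ℝ) :=
          Real.rpow_le_rpow_of_exponent_le one_le_two (by push_cast; exact hN1)
      _ = 2 ^ (N + 1) := Real.rpow_natCast _ _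
  have hdeg : ((N + 1 : ℕ) : ℝ) * (2 * (s - 1)) ≤ r := by
    have e1 : (N + 1) * (2 * (s - 1)) ≤ r := by
      calc (N + 1) * (2 * (s - 1)) = (s - 1) * (2 * 1 * (N + 1)) := by ring
        _ ≤ (s - 1) * (2 * n * (N + 1)) := by gcongr
        _ ≤ r := hs1
    have e2 : (((N + 1) * (2 * (s - 1)) : ℕ) : ℝ) ≤ r := by exact_mod_cast e1
    rwa [Nat.cast_mul, Nat.cast_mul, Nat.cast_sub hs_one, Nat.cast_one,
      Nat.cast_ofNat] at e2
  have hsecond : (n : ℝ) * (2 * ((N + 1 : ℕ) * (2 * ((s : ℝ) - 1)) + 1) * (1 / 2) ^ (N + 1)) ≤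
      t := by
    have e1 : 2 * ((N + 1 : ℕ) * (2 * ((s : ℝ) - 1)) + 1) * (1 / 2) ^ (N + 1) ≤
        2 * ((r : ℝ) + 1) * (1 / (4 * r ^ 3)) := by
      gcongr
    have e2 : 2 * ((r : ℝ) + 1) * (1 / (4 * r ^ 3)) ≤ 1 / r ^ 2 := by
      rw [mul_one_div, div_le_div_iff₀ (by positivity) (by positivity)]
      have : 0 ≤ (r : ℝ) ^ 2 * (2 * (r - 1)) := mul_nonneg (sq_nonneg _) (by linarith)
      nlinarith
    calc _ ≤ (n : ℝ) * (1 / r ^ 2) := by gcongr; exact e1.trans e2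
      _ ≤ ((n : ℝ) ^ 2 * (d : ℝ) ^ 2) * (L ^ 3 / r ^ 2) := by
          gcongr
          · nlinarith [one_le_pow₀ hd1 (n := 2)]
          · exact one_le_pow₀ hL1
  have ht0 : 0 ≤ t := by positivity
  have htle : 769 * t ≤ 3 := by
    have e1 : t * (r : ℝ) ^ 2 = n ^ 2 * d ^ 2 * L ^ 3 := by rw [ht]; field_simp
    have e2 := logb_two_sq_le hr0 hL9
    have e3 : 540 * (t * (r : ℝ) ^ 2) ≤ 2.1 * r ^ 2 := by
      calc 540 * (t * (r : ℝ) ^ 2) = (540 * ((n : ℝ) ^ 2 * (d : ℝ) ^ 2) * L) * L ^ 2 := by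
            rw [e1]; ring
        _ ≤ (r : ℝ) * (2.1 * r) := by gcongr
        _ = 2.1 * (r : ℝ) ^ 2 := by ring
    have e4 : 540 * t ≤ 2.1 := by
      refine le_of_mul_le_mul_right ?_ (by positivity : (0 : ℝ) < r ^ 2)
      linarith
    linarith
  refine (exp_sub_one_le_of_le (by linarith) ht0 htle).trans ?_
  have hn3 : (n : ℝ) ^ 2 ≤ (n : ℝ) ^ 3 := pow_le_pow_right₀ hn1 (by norm_num)
  rw [ht, ← mul_assoc, ← mul_assoc]
  gcongr

end ChebSOS

end

theorem mainTheorem1 :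
    ∃ c₁ c₂ : ℝ, 0 < c₁ ∧ c₁ ≤ 70458 ∧ 0 < c₂ ∧ c₂ ≤ 540 ∧
      ∀ (n d : ℕ) (f : MvPolynomial (Fin n) ℝ), f.totalDegree ≤ d →
        (∀ x ∈ ChebSOS.cube n, 0 ≤ MvPolynomial.eval x f) →
        ∀ r : ℕ, 2 ≤ r → n ∣ r →
          c₂ * (n : ℝ) ^ 2 * (d : ℝ) ^ 2 ≤ (r : ℝ) / Real.logb 2 r →
          ∃ p ∈ ChebSOS.sosCone n r,
            ChebSOS.chebNorm (p - f) ≤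
              c₁ * (n : ℝ) ^ 3 * (d : ℝ) ^ 2 * ChebSOS.chebNorm f *
                (Real.logb 2 r ^ 3 / (r : ℝ) ^ 2) ∧
            ∃ s N : ℕ, 1 ≤ s ∧ 2 ≤ N ∧ Even N ∧
              IsSumSq (ChebSOS.geomTrunc (ChebSOS.fejer s) s N) ∧
              ∀ x ∈ ChebSOS.cube n,
                MvPolynomial.eval x p =
                  (∏ i, (ChebSOS.geomTrunc (ChebSOS.fejer s) s N).eval (x i)) *
                    ChebSOS.kerOp (ChebSOS.fejer s) s f x := by
  refine ⟨70458, 540, by norm_num, le_rfl, by norm_num, le_rfl, ?_⟩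
  intro n d f hdeg hf r hr hnr hrd
  have hn : 1 ≤ n := Nat.pos_of_ne_zero fun h => by
    rw [h, zero_dvd_iff] at hnr
    omega
  rcases Nat.eq_zero_or_pos d with rfl | hd
  · refine ⟨ChebSOS.sosApprox n 1 2 1 f,
      ChebSOS.sosApprox_mem_sosCone le_rfl even_two (by simp) hf, ?_, 1, 2, le_rfl, le_rfl,
      even_two, ChebSOS.isSumSq_geomTrunc le_rfl even_two,
      fun x _ => ChebSOS.eval_sosApprox le_rfl (by norm_num) hdeg x⟩
    have h := ChebSOS.chebNorm_sosApprox_sub_le (N := 2) (Q := 1) le_rfl zero_le_one (by norm_num)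
      hdeg (η := 0) (by
        rw [ChebSOS.kerDefect_one, zero_pow (by norm_num), ChebSOS.coordNorm_zero])
    simpa using h
  · obtain ⟨s, N, hs, hds, hN2, hNe, hdegree, hbound⟩ :=
      ChebSOS.exists_parameters hn hd hr hrd
    have hQ : d + 2 * (s - 1) < 2 * (d + s) := by omega
    refine ⟨ChebSOS.sosApprox n s N (d + s) f,
      ChebSOS.sosApprox_mem_sosCone hs hNe hdegree hf, ?_, s, N, hs, hN2,
      hNe, ChebSOS.isSumSq_geomTrunc hs hNe, fun x _ => ChebSOS.eval_sosApprox hs hQ hdeg x⟩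
    refine (ChebSOS.chebNorm_sosApprox_sub_le hs hds hQ hdeg
      (ChebSOS.coordNorm_kerDefect_pow_le hs (N + 1))).trans ?_
    refine (mul_le_mul_of_nonneg_right hbound (ChebSOS.coordNorm_nonneg _ f)).trans (le_of_eq ?_)
    rw [ChebSOS.chebNorm_eq_coordNorm f]
    ring
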